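/- Let $G$ be a discrete group with identity $e$, and let $\omega:G\to[1,\infty)$ be a weight, i.e. $\omega(gh)\le\omega(g)\omega(h)$ for all $g,h\in G$. Let $\mathcal A=\ell^1(G,\omega)$ be the Banach algebra, under convolution, of all functions $f:G\to\mathbb C$ with $\|f\|=\sum_{g}|f(g)|\,\omega(g)<\infty$. It is a dual Banach algebra with predual $c_0(G,1/\omega)$, the space of all $\varphi:G\to\mathbb C$ with $\varphi/\omega\in c_0(G)$, under the pairing $\langle f,\varphi\rangle=\sum_g f(g)\varphi(g)$. Write $\delta_k\in\mathcal A$ for the point mass at $k\in G$. Definitions. A derivation $D:\mathcal A\to E$ into a Banach $\mathcal A$-bimodule $E$ (a Banach space with bounded, not necessarily unital, bimodule actions) is a bounded linear map with $D(ab)=D(a)\cdot b+a\cdot D(b)$; it is inner at $a_0\in\mathcal A$ if $D(a_0)=a_0\cdot x-x\cdot a_0$ for some $x\in E$. The algebra $\mathcal A$ is pointwise amenable at $a_0$ if, for every Banach $\mathcal A$-bimodule $X$, every derivation $D:\mathcal A\to X^*$ into the dual bimodule is inner at $a_0$, and pointwise amenable if this holds at each $a_0\in\mathcal A$. A dual bimodule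 $X^*$ is normal if, for each $\phi\in X^*$, the maps $a\mapsto a\cdot\phi$ and $a\mapsto\phi\cdot a$ are $w^*$-continuous from $\mathcal A$ to $X^*$. The algebra $\mathcal A$ is pointwise Connes amenable if, for each $a_0\in\mathcal A$, every $w^*$-continuous derivation from $\mathcal A$ into a normal dual Banach $\mathcal A$-bimodule is inner at $a_0$. For $g,h\in G$ put $\Omega(g,h)=\dfrac{\omega(gh)}{\omega(g)\omega(h)}$, and let $J_h:\ell^\infty(G)\to\ell^\infty(G)$ be the bounded operator $$J_h(f)=\bigl(f_{hg}\,\Omega(h,g)\,\omega(h)\,\Omega(g^{-1},h^{-1})\,\omega(h^{-1})\bigr)_{g\in G}.$$ The group $G$ is pointwise $\omega$-amenable if for each $h\in G$ there is $N\in\ell^\infty(G)^*$ with $\langle(\Omega(g,g^{-1}))_{g\in G},N\rangle=1$ and $J_h^*(N)=N$. Theorem. Consider the following statements: 1. $\mathcal A$ is pointwise amenable. 2. $\mathcal A$ is pointwise Connes amenable. 3. $G$ is pointwise $\omega$-amenable. 4. $\mathcal A$ is pointwise amenable at $\delta_k$ for each $k\in G$. Then $(1)\Rightarrow(2)\Rightarrow(3)\Rightarrow(4)$.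 -/

import Mathlib

universe u v w

noncomputable section

/-! ### Banach bimodules, derivations and pointwise amenability -/

section Bimodules

variable (A : Type u) [NonUnitalNormedRing A] [NormedSpace ℂ A]

/-- A (not necessarily unital) Banach `A`-bimodule structure on `X`: the jointly bounded bilinear
actions `left a x = a · x` and `right a x = x · a`, with the bimodule axioms. -/
structure BanachBimodule (X : Type w) [NormedAddCommGroup X] [NormedSpace ℂ X] where
  left : A →L[ℂ] X →L[ℂ] X
  right : A →L[ℂ] X →L[ℂ] X
  left_mul : ∀ a b x, left (a * b) x = left a (left b x)
  right_mul : ∀ a b x, right (a * b) x = right b (right a x)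
  left_right : ∀ a b x, right b (left a x) = left a (right b x)

namespace BanachBimodule

variable {A}
variable {X : Type w} [NormedAddCommGroup X] [NormedSpace ℂ X]

/-- The dual bimodule: `⟨x, a · φ⟩ = ⟨x · a, φ⟩` and `⟨x, φ · a⟩ = ⟨a · x, φ⟩`. -/
def dual (B : BanachBimodule A X) : BanachBimodule A (StrongDual ℂ X) where
  left := (ContinuousLinearMap.compL ℂ X X ℂ).flip ∘L B.right
  right := (ContinuousLinearMap.compL ℂ X X ℂ).flip ∘L B.left
  left_mul a b φ := by ext x; simp [B.right_mul]
  right_mul a b φ := by ext x; simp [B.left_mul]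
  left_right a b φ := by ext x; simp [B.left_right]

theorem dual_left_apply (B : BanachBimodule A X) (a : A) (φ : StrongDual ℂ X) (x : X) :
    B.dual.left a φ x = φ (B.right a x) := rfl

theorem dual_right_apply (B : BanachBimodule A X) (a : A) (φ : StrongDual ℂ X) (x : X) :
    B.dual.right a φ x = φ (B.left a x) := rfl

/-- A bounded linear map `D : A → X` is a derivation if `D(ab) = D(a) · b + a · D(b)`. -/
def IsDerivation (B : BanachBimodule A X) (D : A →L[ℂ] X) : Prop :=
  ∀ a b, D (a * b) = B.right b (D a) + B.left a (D b)

/-- `D` is pointwise inner at `a₀`: `D(a₀) = a₀ · x - x · a₀` for some `x`. -/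
def IsInnerAt (B : BanachBimodule A X) (D : A →L[ℂ] X) (a₀ : A) : Prop :=
  ∃ x, D a₀ = B.left a₀ x - B.right a₀ x

/-- The algebra as a bimodule over itself. -/
def self (A : Type u) [NonUnitalNormedRing A] [NormedSpace ℂ A]
    [IsScalarTower ℂ A A] [SMulCommClass ℂ A A] : BanachBimodule A A where
  left := ContinuousLinearMap.mul ℂ A
  right := (ContinuousLinearMap.mul ℂ A).flip
  left_mul a b x := by simp [mul_assoc]
  right_mul a b x := by simp [mul_assoc]
  left_right a b x := by simp [mul_assoc]

end BanachBimodule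

/-- `A` is pointwise amenable at `a₀`: every derivation into a dual Banach bimodule is inner
at `a₀`. -/
def PointwiseAmenableAt (a₀ : A) : Prop :=
  ∀ (X : Type w) [NormedAddCommGroup X] [NormedSpace ℂ X] [CompleteSpace X]
    (B : BanachBimodule A X) (D : A →L[ℂ] StrongDual ℂ X),
    B.dual.IsDerivation D → B.dual.IsInnerAt D a₀

/-- `A` is pointwise amenable. -/
def PointwiseAmenable : Prop := ∀ a : A, PointwiseAmenableAt.{u, w} A a

/-- A predual of `A`, making `A` a dual Banach algebra: a closed submodule `A_*` of the
dual bimodule `A^*` such that `A = (A_*)^*` through the canonical map `a ↦ (φ ↦ φ a)`, which is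
required to be isometric and onto. -/
structure Predual [IsScalarTower ℂ A A] [SMulCommClass ℂ A A] where
  carrier : Submodule ℂ (StrongDual ℂ A)
  isClosed : IsClosed (carrier : Set (StrongDual ℂ A))
  left_mem : ∀ a, ∀ φ ∈ carrier, (BanachBimodule.self A).dual.left a φ ∈ carrier
  right_mem : ∀ a, ∀ φ ∈ carrier, (BanachBimodule.self A).dual.right a φ ∈ carrier
  isometric : ∀ a, IsLUB ((fun φ : StrongDual ℂ A => ‖φ a‖) '' {φ | φ ∈ carrier ∧ ‖φ‖ ≤ 1}) ‖a‖
  surjective : ∀ Λ : carrier →ₗ[ℂ] ℂ,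
    (∃ C : ℝ, ∀ φ : carrier, ‖Λ φ‖ ≤ C * ‖(φ : StrongDual ℂ A)‖) →
      ∃ a : A, ∀ φ : carrier, Λ φ = (φ : StrongDual ℂ A) a

variable {A}
variable [IsScalarTower ℂ A A] [SMulCommClass ℂ A A]

/-- The `w*`-topology `σ(A, A_*)` of a dual Banach algebra. -/
@[reducible] def Predual.weakStar (P : Predual A) : TopologicalSpace A :=
  TopologicalSpace.induced (fun (a : A) (φ : P.carrier) => (φ : StrongDual ℂ A) a) inferInstance

/-- Continuity of `T : A → X^*` for the `w*`-topologies `σ(A, A_*)` and `σ(X^*, X)`. -/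
def Predual.WStarContinuous (P : Predual A) {X : Type w} [NormedAddCommGroup X] [NormedSpace ℂ X]
    (T : A → StrongDual ℂ X) : Prop :=
  @Continuous A (WeakDual ℂ X) P.weakStar inferInstance (fun a => StrongDual.toWeakDual (T a))

theorem Predual.wStarContinuous_iff (P : Predual A) {X : Type w} [NormedAddCommGroup X]
    [NormedSpace ℂ X] (T : A → StrongDual ℂ X) :
    P.WStarContinuous T ↔ ∀ x, @Continuous A ℂ P.weakStar inferInstance (fun a => T a x) := by
  constructor
  · intro h x
    exact @Continuous.comp _ _ _ P.weakStar _ _ _ _ (WeakDual.eval_continuous x) h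
  · intro h
    exact @WeakDual.continuous_of_continuous_eval _ _ _ _ _ _ _ _ _ _ P.weakStar _ h

/-- The dual Banach bimodule `X^*` is normal: for each `φ ∈ X^*` the maps `a ↦ a · φ` and
`a ↦ φ · a` are `w*`-continuous. -/
def BanachBimodule.IsNormalDual (P : Predual A) {X : Type w} [NormedAddCommGroup X]
    [NormedSpace ℂ X] (B : BanachBimodule A X) : Prop :=
  ∀ φ : StrongDual ℂ X, P.WStarContinuous (fun a => B.dual.left a φ) ∧
    P.WStarContinuous (fun a => B.dual.right a φ)

/-- The dual Banach algebra `A` with predual `P` is pointwise Connes amenable at `a₀`: every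
`w*`-continuous derivation into a normal dual Banach bimodule is inner at `a₀`. -/
def PointwiseConnesAmenableAt (P : Predual A) (a₀ : A) : Prop :=
  ∀ (X : Type w) [NormedAddCommGroup X] [NormedSpace ℂ X] [CompleteSpace X]
    (B : BanachBimodule A X), B.IsNormalDual P →
    ∀ D : A →L[ℂ] StrongDual ℂ X, B.dual.IsDerivation D → P.WStarContinuous D →
      B.dual.IsInnerAt D a₀

/-- The dual Banach algebra `A` with predual `P` is pointwise Connes amenable. -/
def PointwiseConnesAmenable (P : Predual A) : Prop :=
  ∀ a : A, PointwiseConnesAmenableAt.{u, w} P a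

end Bimodules

/-! ### Weights and Beurling algebras -/

/-- A weight on a discrete group: `ω : G → [1, ∞)` with `ω(gh) ≤ ω(g) ω(h)`. -/
structure Weight (G : Type u) [Group G] where
  toFun : G → ℝ
  one_le' : ∀ g, 1 ≤ toFun g
  mul_le' : ∀ g h, toFun (g * h) ≤ toFun g * toFun h

namespace Weight

variable {G : Type u} [Group G]

instance : CoeFun (Weight G) (fun _ => G → ℝ) := ⟨Weight.toFun⟩

theorem one_le (ω : Weight G) (g : G) : 1 ≤ ω g := ω.one_le' g

theorem mul_le (ω : Weight G) (g h : G) : ω (g * h) ≤ ω g * ω h := ω.mul_le' g h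

theorem pos (ω : Weight G) (g : G) : 0 < ω g := lt_of_lt_of_le one_pos (ω.one_le g)

theorem nonneg (ω : Weight G) (g : G) : 0 ≤ ω g := (ω.pos g).le

end Weight

/-- The functions `f : G → ℂ` with `∑ |f g| ω(g) < ∞`. -/
def beurlingSubmodule {G : Type u} [Group G] (ω : Weight G) : Submodule ℂ (G → ℂ) where
  carrier := {f | Summable fun g => ‖f g‖ * ω g}
  zero_mem' := by simp
  add_mem' {f h} hf hh := by
    refine Summable.of_nonneg_of_le (fun g => mul_nonneg (norm_nonneg _) (ω.nonneg g))
      (fun g => ?_) (hf.add hh)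
    rw [← add_mul]
    exact mul_le_mul_of_nonneg_right (norm_add_le _ _) (ω.nonneg g)
  smul_mem' c f hf := by
    have := Summable.mul_left ‖c‖ hf
    simpa [mul_assoc] using this

/-- The Beurling algebra `ℓ¹(G, ω)`. -/
def Beurling {G : Type u} [Group G] (ω : Weight G) : Type u := beurlingSubmodule ω

namespace Beurling

variable {G : Type u} [Group G] {ω : Weight G}

instance : AddCommGroup (Beurling ω) := inferInstanceAs (AddCommGroup (beurlingSubmodule ω))

instance : Module ℂ (Beurling ω) := inferInstanceAs (Module ℂ (beurlingSubmodule ω))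

instance : CoeFun (Beurling ω) (fun _ => G → ℂ) := ⟨fun f => f.1⟩

@[ext] theorem ext {f h : Beurling ω} (H : ∀ g, f g = h g) : f = h := Subtype.ext (funext H)

@[simp] theorem zero_apply (g : G) : (0 : Beurling ω) g = 0 := rfl
@[simp] theorem add_apply (f h : Beurling ω) (g : G) : (f + h) g = f g + h g := rfl
@[simp] theorem smul_apply (c : ℂ) (f : Beurling ω) (g : G) : (c • f) g = c * f g := rfl

/-- The norm of `ℓ¹(G, ω)`. -/
instance : Norm (Beurling ω) := ⟨fun f => ∑' g, ‖f g‖ * ω g⟩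

theorem norm_def (f : Beurling ω) : ‖f‖ = ∑' g, ‖f g‖ * ω g := rfl

theorem summable (f : Beurling ω) : Summable fun g => ‖f g‖ * ω g := f.2

theorem term_nonneg (f : Beurling ω) (g : G) : 0 ≤ ‖f g‖ * ω g :=
  mul_nonneg (norm_nonneg _) (ω.nonneg g)

theorem normedSpaceCore : NormedSpace.Core ℂ (Beurling ω) where
  norm_nonneg f := tsum_nonneg f.term_nonneg
  norm_smul c f := by
    simp only [norm_def, smul_apply, norm_mul, mul_assoc, tsum_mul_left]
  norm_triangle f h := by
    rw [norm_def, norm_def, norm_def, ← f.summable.tsum_add h.summable]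
    refine (f + h).summable.tsum_le_tsum (fun g => ?_) (f.summable.add h.summable)
    rw [← add_mul]
    exact mul_le_mul_of_nonneg_right (norm_add_le _ _) (ω.nonneg g)
  norm_eq_zero_iff f := by
    constructor
    · intro h
      have h0 : HasSum (fun g => ‖f g‖ * ω g) 0 := by
        have := f.summable.hasSum
        rwa [← norm_def, h] at this
      have h1 := (hasSum_zero_iff_of_nonneg f.term_nonneg).1 h0
      ext g
      have h2 := congrFun h1 g
      simpa [(ω.pos g).ne'] using h2
    · rintro rfl
      simp [norm_def]

instance : NormedAddCommGroup (Beurling ω) := NormedAddCommGroup.ofCore normedSpaceCore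

instance : NormedSpace ℂ (Beurling ω) := NormedSpace.ofCore normedSpaceCore

theorem norm_apply_le (f : Beurling ω) (g : G) : ‖f g‖ * ω g ≤ ‖f‖ :=
  f.summable.le_tsum g (fun j _ => f.term_nonneg j)

/-- The isometric isomorphism `f ↦ ω f` onto `ℓ¹(G)`. -/
def toLp (ω : Weight G) : Beurling ω ≃ₗᵢ[ℂ] lp (fun _ : G => ℂ) 1 where
  toFun f := ⟨fun g => (ω g : ℂ) * f g, by
    refine memℓp_gen ?_
    simpa [abs_of_pos (ω.pos _), mul_comm] using f.summable⟩
  invFun f := ⟨fun g => (ω g : ℂ)⁻¹ * f g, by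
    have h := (lp.memℓp f).summable (by simp)
    refine h.congr (fun g => ?_)
    have := (ω.pos g).ne'
    simp [abs_of_pos (ω.pos g)]
    field_simp⟩
  left_inv f := by
    ext g
    have : (ω g : ℂ) ≠ 0 := by exact_mod_cast (ω.pos g).ne'
    change (ω g : ℂ)⁻¹ * ((ω g : ℂ) * f g) = f g
    field_simp
  right_inv f := by
    ext g
    have : (ω g : ℂ) ≠ 0 := by exact_mod_cast (ω.pos g).ne'
    change (ω g : ℂ) * ((ω g : ℂ)⁻¹ * f g) = f g
    field_simp
  map_add' f h := by
    ext g
    exact mul_add _ _ _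
  map_smul' c f := by
    ext g
    exact mul_left_comm _ _ _
  norm_map' f := by
    rw [lp.norm_eq_tsum_rpow (by simp), norm_def]
    simp only [ENNReal.toReal_one, Real.rpow_one, div_one]
    refine tsum_congr (fun g => ?_)
    change ‖(ω g : ℂ) * f g‖ = _
    simp [abs_of_pos (ω.pos _), mul_comm]

instance : CompleteSpace (Beurling ω) :=
  (toLp ω).toIsometryEquiv.completeSpace_iff.2 inferInstance

/-! Convolution -/

theorem conv_summable_aux (f h : Beurling ω) :
    Summable fun p : G × G => (‖f p.2‖ * ω p.2) * (‖h (p.2⁻¹ * p.1)‖ * ω (p.2⁻¹ * p.1)) := by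
  have H := f.summable.mul_of_nonneg h.summable f.term_nonneg h.term_nonneg
  let e : G × G ≃ G × G :=
    { toFun := fun p => (p.2, p.2⁻¹ * p.1)
      invFun := fun p => (p.1 * p.2, p.1)
      left_inv := fun p => by simp
      right_inv := fun p => by simp }
  exact e.summable_iff.2 H

theorem conv_tsum_aux (f h : Beurling ω) :
    ∑' p : G × G, (‖f p.2‖ * ω p.2) * (‖h (p.2⁻¹ * p.1)‖ * ω (p.2⁻¹ * p.1)) = ‖f‖ * ‖h‖ := by
  have H := f.summable.mul_of_nonneg h.summable f.term_nonneg h.term_nonneg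
  let e : G × G ≃ G × G :=
    { toFun := fun p => (p.2, p.2⁻¹ * p.1)
      invFun := fun p => (p.1 * p.2, p.1)
      left_inv := fun p => by simp
      right_inv := fun p => by simp }
  rw [norm_def, norm_def, f.summable.tsum_mul_tsum h.summable H]
  exact e.tsum_eq (fun p : G × G => (‖f p.1‖ * ω p.1) * (‖h p.2‖ * ω p.2))

theorem conv_bound (f h : Beurling ω) (x y : G) :
    ‖f y * h (y⁻¹ * x)‖ * ω x ≤ (‖f y‖ * ω y) * (‖h (y⁻¹ * x)‖ * ω (y⁻¹ * x)) := by
  have h1 : ω x ≤ ω y * ω (y⁻¹ * x) := by simpa using ω.mul_le y (y⁻¹ * x)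
  rw [norm_mul]
  calc _ ≤ ‖f y‖ * ‖h (y⁻¹ * x)‖ * (ω y * ω (y⁻¹ * x)) :=
        mul_le_mul_of_nonneg_left h1 (by positivity)
    _ = _ := by ring

theorem conv_norm_summable (f h : Beurling ω) (x : G) :
    Summable fun y => ‖f y * h (y⁻¹ * x)‖ := by
  have h1 := (conv_summable_aux f h).prod_factor x
  refine Summable.of_nonneg_of_le (fun _ => norm_nonneg _) (fun y => ?_) h1
  refine le_trans ?_ (conv_bound f h x y)
  exact le_mul_of_one_le_right (norm_nonneg _) (ω.one_le x)

theorem conv_summable (f h : Beurling ω) (x : G) :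
    Summable fun y => f y * h (y⁻¹ * x) := (conv_norm_summable f h x).of_norm

theorem conv_term_le (f h : Beurling ω) (x : G) :
    ‖∑' y, f y * h (y⁻¹ * x)‖ * ω x ≤
      ∑' y, (‖f y‖ * ω y) * (‖h (y⁻¹ * x)‖ * ω (y⁻¹ * x)) := by
  have h1 := (conv_summable_aux f h).prod_factor x
  calc _ ≤ (∑' y, ‖f y * h (y⁻¹ * x)‖) * ω x :=
        mul_le_mul_of_nonneg_right (norm_tsum_le_tsum_norm (conv_norm_summable f h x)) (ω.nonneg x)
    _ = ∑' y, ‖f y * h (y⁻¹ * x)‖ * ω x := tsum_mul_right.symm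
    _ ≤ _ := ((conv_norm_summable f h x).mul_right _).tsum_le_tsum (conv_bound f h x) h1

/-- The convolution product `(f * h)(x) = ∑_y f(y) h(y⁻¹ x)`. -/
instance : Mul (Beurling ω) := ⟨fun f h => ⟨fun x => ∑' y, f y * h (y⁻¹ * x),
  Summable.of_nonneg_of_le (fun x => mul_nonneg (norm_nonneg _) (ω.nonneg x)) (conv_term_le f h)
    (conv_summable_aux f h).prod⟩⟩

theorem mul_apply (f h : Beurling ω) (x : G) : (f * h) x = ∑' y, f y * h (y⁻¹ * x) := rfl

theorem norm_mul_le' (f h : Beurling ω) : ‖f * h‖ ≤ ‖f‖ * ‖h‖ := by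
  rw [← conv_tsum_aux, (conv_summable_aux f h).tsum_prod, norm_def]
  exact (f * h).summable.tsum_le_tsum (conv_term_le f h) (conv_summable_aux f h).prod

theorem add_mul' (f₁ f₂ h : Beurling ω) : (f₁ + f₂) * h = f₁ * h + f₂ * h := by
  ext x
  simp only [mul_apply, add_apply, add_mul]
  exact (conv_summable f₁ h x).tsum_add (conv_summable f₂ h x)

theorem mul_add' (f h₁ h₂ : Beurling ω) : f * (h₁ + h₂) = f * h₁ + f * h₂ := by
  ext x
  simp only [mul_apply, add_apply, mul_add]
  exact (conv_summable f h₁ x).tsum_add (conv_summable f h₂ x)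

theorem smul_mul' (c : ℂ) (f h : Beurling ω) : (c • f) * h = c • (f * h) := by
  ext x
  simp only [mul_apply, smul_apply, mul_assoc, tsum_mul_left]

theorem mul_smul' (c : ℂ) (f h : Beurling ω) : f * (c • h) = c • (f * h) := by
  ext x
  simp only [mul_apply, smul_apply, mul_left_comm _ c, tsum_mul_left]

open Classical in
/-- The point mass `δ_g`. -/
def delta (ω : Weight G) (g : G) : Beurling ω :=
  ⟨Pi.single g 1, summable_of_ne_finset_zero (s := {g}) (fun x hx => by
    simp [Pi.single_eq_of_ne (show x ≠ g by simpa using hx)])⟩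

open Classical in
theorem delta_apply (g x : G) : delta ω g x = if x = g then 1 else 0 := Pi.single_apply g 1 x

theorem norm_delta (g : G) : ‖delta ω g‖ = ω g := by
  classical
  rw [norm_def, tsum_eq_single g]
  · simp [delta_apply]
  · intro x hx
    simp [delta_apply, hx]

theorem delta_mul_delta (g h : G) : delta ω g * delta ω h = delta ω (g * h) := by
  classical
  ext x
  rw [mul_apply, tsum_eq_single g]
  · simp [delta_apply, inv_mul_eq_iff_eq_mul]
  · intro y hy
    simp [delta_apply, hy]

/-- The evaluation functional `f ↦ f g`. -/
def coord (ω : Weight G) (g : G) : StrongDual ℂ (Beurling ω) :=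
  LinearMap.mkContinuous
    { toFun := fun f => f g, map_add' := fun _ _ => rfl, map_smul' := fun _ _ => rfl } 1
    (fun f => by
      rw [one_mul]
      exact (le_mul_of_one_le_right (norm_nonneg _) (ω.one_le g)).trans (norm_apply_le f g))

@[simp] theorem coord_apply (g : G) (f : Beurling ω) : coord ω g f = f g := rfl

theorem hasSum_delta (f : Beurling ω) : HasSum (fun g => f g • delta ω g) f := by
  classical
  have h1 : Summable (fun g => f g • delta ω g) := by
    refine Summable.of_norm ?_
    simpa only [norm_smul, norm_delta] using f.summable
  convert h1.hasSum using 1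
  ext x
  have h2 := (coord ω x).map_tsum h1
  simp only [coord_apply] at h2
  rw [h2, tsum_eq_single x]
  · simp [delta_apply]
  · intro y hy
    simp [delta_apply, hy.symm]

theorem clm_ext {F : Type*} [AddCommMonoid F] [Module ℂ F] [TopologicalSpace F] [T2Space F]
    {S T : Beurling ω →L[ℂ] F} (H : ∀ g, S (delta ω g) = T (delta ω g)) : S = T := by
  ext f
  have h1 := (hasSum_delta f).mapL S
  have h2 := (hasSum_delta f).mapL T
  simp only [map_smul, H] at h1 h2
  exact h1.unique h2

/-- Convolution as a bounded bilinear map. -/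
def mulCLM (ω : Weight G) : Beurling ω →L[ℂ] Beurling ω →L[ℂ] Beurling ω :=
  LinearMap.mkContinuous₂ (LinearMap.mk₂ ℂ (fun f h => f * h) add_mul' smul_mul' mul_add'
    mul_smul') 1 (fun f h => by simpa using norm_mul_le' f h)

theorem mulCLM_apply (f h : Beurling ω) : mulCLM ω f h = f * h := rfl

theorem mul_assoc' (f h k : Beurling ω) : f * h * k = f * (h * k) := by
  have h1 : ∀ (a b : G) (k : Beurling ω),
      delta ω a * delta ω b * k = delta ω a * (delta ω b * k) := fun a b k => by
    have : mulCLM ω (delta ω a * delta ω b) = mulCLM ω (delta ω a) ∘L mulCLM ω (delta ω b) :=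
      clm_ext fun c => by simp [mulCLM_apply, delta_mul_delta, mul_assoc]
    exact DFunLike.congr_fun this k
  have h2 : ∀ (a : G) (h k : Beurling ω), delta ω a * h * k = delta ω a * (h * k) :=
    fun a h k => by
      have : (mulCLM ω).flip k ∘L mulCLM ω (delta ω a) =
          mulCLM ω (delta ω a) ∘L (mulCLM ω).flip k := clm_ext fun b => h1 a b k
      exact DFunLike.congr_fun this h
  have : (mulCLM ω).flip k ∘L (mulCLM ω).flip h = (mulCLM ω).flip (h * k) :=
    clm_ext fun a => h2 a h k
  exact DFunLike.congr_fun this f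

instance : One (Beurling ω) := ⟨delta ω 1⟩

theorem one_def : (1 : Beurling ω) = delta ω 1 := rfl

theorem one_mul' (f : Beurling ω) : 1 * f = f := by
  have : mulCLM ω 1 = ContinuousLinearMap.id ℂ _ :=
    clm_ext fun g => by simp [mulCLM_apply, one_def, delta_mul_delta]
  exact DFunLike.congr_fun this f

theorem mul_one' (f : Beurling ω) : f * 1 = f := by
  have : (mulCLM ω).flip 1 = ContinuousLinearMap.id ℂ _ :=
    clm_ext fun g => by simp [mulCLM_apply, one_def, delta_mul_delta]
  exact DFunLike.congr_fun this f

/-- The Banach algebra `ℓ¹(G, ω)` under convolution. -/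
instance : NormedRing (Beurling ω) :=
  { (inferInstance : NormedAddCommGroup (Beurling ω)) with
    mul := (· * ·)
    one := 1
    left_distrib := mul_add'
    right_distrib := add_mul'
    zero_mul := fun f => by simpa using smul_mul' 0 0 f
    mul_zero := fun f => by simpa using mul_smul' 0 f 0
    mul_assoc := mul_assoc'
    one_mul := one_mul'
    mul_one := mul_one'
    norm_mul_le := norm_mul_le' }

instance : NormedAlgebra ℂ (Beurling ω) :=
  { Algebra.ofModule smul_mul' mul_smul' with
    norm_smul_le := fun c f => norm_smul_le c f }

/-! ### The predual `c₀(G, 1/ω)` -/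

theorem norm_functional_delta_le (φ : StrongDual ℂ (Beurling ω)) (g : G) :
    ‖φ (delta ω g)‖ / ω g ≤ ‖φ‖ := by
  rw [div_le_iff₀ (ω.pos g)]
  simpa [norm_delta] using φ.le_opNorm (delta ω g)

theorem functional_apply (φ : StrongDual ℂ (Beurling ω)) (f : Beurling ω) :
    HasSum (fun g => f g * φ (delta ω g)) (φ f) := by
  simpa using (hasSum_delta f).mapL φ

/-- The functionals `φ` on `ℓ¹(G, ω)` for which `g ↦ φ(δ_g)` belongs to `c₀(G, 1/ω)`, that is,
`φ(δ_g) / ω(g) → 0` as `g` leaves the finite subsets of `G`. -/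
def cZero (ω : Weight G) : Submodule ℂ (StrongDual ℂ (Beurling ω)) where
  carrier := {φ | Filter.Tendsto (fun g => ‖φ (delta ω g)‖ / ω g) Filter.cofinite (nhds 0)}
  zero_mem' := by simpa using tendsto_const_nhds
  add_mem' {φ ψ} hφ hψ := by
    have H := Filter.Tendsto.add hφ hψ
    rw [add_zero] at H
    refine squeeze_zero (fun g => div_nonneg (norm_nonneg _) (ω.nonneg g)) (fun g => ?_) H
    rw [← add_div]
    exact div_le_div_of_nonneg_right (norm_add_le _ _) (ω.nonneg g)
  smul_mem' c φ hφ := by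
    have H := Filter.Tendsto.const_mul ‖c‖ hφ
    rw [mul_zero] at H
    refine H.congr (fun g => ?_)
    simp [mul_div_assoc]

theorem mem_cZero {φ : StrongDual ℂ (Beurling ω)} : φ ∈ cZero ω ↔
    Filter.Tendsto (fun g => ‖φ (delta ω g)‖ / ω g) Filter.cofinite (nhds 0) := Iff.rfl

theorem isClosed_cZero : IsClosed (cZero ω : Set (StrongDual ℂ (Beurling ω))) := by
  refine isClosed_of_closure_subset (fun φ hφ => ?_)
  change Filter.Tendsto _ _ _
  rw [Metric.tendsto_nhds]
  intro ε hε
  obtain ⟨ψ, hψ, hd⟩ := Metric.mem_closure_iff.1 hφ (ε / 2) (half_pos hε)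
  have h1 := Metric.tendsto_nhds.1 (mem_cZero.1 hψ) (ε / 2) (half_pos hε)
  filter_upwards [h1] with g hg
  rw [Real.dist_0_eq_abs, abs_of_nonneg (div_nonneg (norm_nonneg _) (ω.nonneg g))] at hg ⊢
  have h2 := norm_functional_delta_le (φ - ψ) g
  rw [dist_eq_norm] at hd
  have h3 : ‖φ (delta ω g)‖ ≤ ‖(φ - ψ) (delta ω g)‖ + ‖ψ (delta ω g)‖ := by
    simpa using norm_add_le ((φ - ψ) (delta ω g)) (ψ (delta ω g))
  have h4 := div_le_div_of_nonneg_right h3 (ω.nonneg g)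
  rw [add_div] at h4
  linarith

theorem cZero_left_mem (a : Beurling ω) (φ : StrongDual ℂ (Beurling ω)) (hφ : φ ∈ cZero ω) :
    (BanachBimodule.self (Beurling ω)).dual.left a φ ∈ cZero ω := by
  let L := (BanachBimodule.self (Beurling ω)).dual.left.flip φ
  have h1 : ∀ s, L (delta ω s) ∈ cZero ω := fun s => by
    have h2 : Filter.Tendsto (fun g : G => g * s) Filter.cofinite Filter.cofinite :=
      (mul_left_injective s).tendsto_cofinite
    have h3 := ((mem_cZero.1 hφ).comp h2).mul_const (ω s)
    rw [zero_mul] at h3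
    refine squeeze_zero (fun g => div_nonneg (norm_nonneg _) (ω.nonneg g)) (fun g => ?_) h3
    have h4 : L (delta ω s) (delta ω g) = φ (delta ω (g * s)) := by
      rw [← delta_mul_delta]; rfl
    rw [h4, Function.comp_apply, div_mul_eq_mul_div, div_le_div_iff₀ (ω.pos _) (ω.pos _)]
    calc _ ≤ ‖φ (delta ω (g * s))‖ * (ω g * ω s) :=
          mul_le_mul_of_nonneg_left (ω.mul_le g s) (norm_nonneg _)
      _ = _ := by ring
  have h5 := (hasSum_delta a).mapL L
  exact isClosed_cZero.mem_of_tendsto h5 (Filter.Eventually.of_forall fun F =>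
    Submodule.sum_mem _ fun s _ => by
      rw [map_smul]; exact Submodule.smul_mem _ _ (h1 s))

theorem cZero_right_mem (a : Beurling ω) (φ : StrongDual ℂ (Beurling ω)) (hφ : φ ∈ cZero ω) :
    (BanachBimodule.self (Beurling ω)).dual.right a φ ∈ cZero ω := by
  let L := (BanachBimodule.self (Beurling ω)).dual.right.flip φ
  have h1 : ∀ s, L (delta ω s) ∈ cZero ω := fun s => by
    have h2 : Filter.Tendsto (fun g : G => s * g) Filter.cofinite Filter.cofinite :=
      (mul_right_injective s).tendsto_cofinite
    have h3 := ((mem_cZero.1 hφ).comp h2).mul_const (ω s)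
    rw [zero_mul] at h3
    refine squeeze_zero (fun g => div_nonneg (norm_nonneg _) (ω.nonneg g)) (fun g => ?_) h3
    have h4 : L (delta ω s) (delta ω g) = φ (delta ω (s * g)) := by
      rw [← delta_mul_delta]; rfl
    rw [h4, Function.comp_apply, div_mul_eq_mul_div, div_le_div_iff₀ (ω.pos _) (ω.pos _)]
    calc _ ≤ ‖φ (delta ω (s * g))‖ * (ω s * ω g) :=
          mul_le_mul_of_nonneg_left (ω.mul_le s g) (norm_nonneg _)
      _ = _ := by ring
  have h5 := (hasSum_delta a).mapL L
  exact isClosed_cZero.mem_of_tendsto h5 (Filter.Eventually.of_forall fun F =>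
    Submodule.sum_mem _ fun s _ => by
      rw [map_smul]; exact Submodule.smul_mem _ _ (h1 s))

theorem norm_functional_le {ψ : StrongDual ℂ (Beurling ω)} {C : ℝ} (hC : 0 ≤ C)
    (H : ∀ g, ‖ψ (delta ω g)‖ ≤ C * ω g) : ‖ψ‖ ≤ C := by
  refine ψ.opNorm_le_bound hC (fun f => ?_)
  rw [← (functional_apply ψ f).tsum_eq, norm_def, ← tsum_mul_left]
  refine tsum_of_norm_bounded (f.summable.mul_left C).hasSum (fun g => ?_)
  rw [norm_mul]
  calc _ ≤ ‖f g‖ * (C * ω g) := mul_le_mul_of_nonneg_left (H g) (norm_nonneg _)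
    _ = _ := by ring

/-- The functional `f ↦ ∑_{g ∈ F} c_g f(g)`. -/
def finFunctional (ω : Weight G) (F : Finset G) (c : G → ℂ) : StrongDual ℂ (Beurling ω) :=
  ∑ g ∈ F, c g • coord ω g

theorem finFunctional_apply (F : Finset G) (c : G → ℂ) (f : Beurling ω) :
    finFunctional ω F c f = ∑ g ∈ F, c g * f g := by
  simp [finFunctional]

open Classical in
theorem finFunctional_delta (F : Finset G) (c : G → ℂ) (g : G) :
    finFunctional ω F c (delta ω g) = if g ∈ F then c g else 0 := by
  simp [finFunctional_apply, delta_apply]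

theorem coord_mem_cZero (g : G) : coord ω g ∈ cZero ω := by
  classical
  refine mem_cZero.2 (tendsto_const_nhds.congr' ?_)
  have : ∀ᶠ x in Filter.cofinite, x ≠ g := (Set.finite_singleton g).compl_mem_cofinite
  filter_upwards [this] with x hx
  simp [delta_apply, hx.symm]

theorem finFunctional_mem (F : Finset G) (c : G → ℂ) : finFunctional ω F c ∈ cZero ω :=
  Submodule.sum_mem _ fun g _ => Submodule.smul_mem _ _ (coord_mem_cZero g)

/-- Coefficients `c` with `|c_g| ≤ ω(g)` and `c_g a_g = |a_g| ω(g)`. -/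
theorem exists_phase (ω : Weight G) (a : G → ℂ) :
    ∃ c : G → ℂ, (∀ g, ‖c g‖ ≤ ω g) ∧ ∀ g, c g * a g = ((‖a g‖ * ω g : ℝ) : ℂ) := by
  refine ⟨fun g => (ω g : ℂ) * (starRingEnd ℂ (a g) / ‖a g‖), fun g => ?_, fun g => ?_⟩
  · rw [norm_mul, Complex.norm_real, Real.norm_of_nonneg (ω.nonneg g)]
    refine mul_le_of_le_one_right (ω.nonneg g) ?_
    simpa using div_self_le_one ‖a g‖
  · rcases eq_or_ne (a g) 0 with h | h
    · simp [h]
    · have h1 : ((‖a g‖ : ℝ) : ℂ) ≠ 0 := by simpa using h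
      have h2 : starRingEnd ℂ (a g) * a g = (‖a g‖ : ℂ) ^ 2 := Complex.conj_mul' (a g)
      push_cast
      field_simp
      rw [mul_assoc, h2]

theorem finFunctional_norm_le {F : Finset G} {c : G → ℂ} (hc : ∀ g, ‖c g‖ ≤ ω g) :
    ‖finFunctional ω F c‖ ≤ 1 := by
  classical
  refine norm_functional_le zero_le_one (fun g => ?_)
  rw [finFunctional_delta, one_mul]
  split_ifs
  · exact hc g
  · simpa using ω.nonneg g

theorem cZero_isometric (a : Beurling ω) :
    IsLUB ((fun φ : StrongDual ℂ (Beurling ω) => ‖φ a‖) '' {φ | φ ∈ cZero ω ∧ ‖φ‖ ≤ 1}) ‖a‖ := by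
  constructor
  · rintro _ ⟨φ, ⟨-, h⟩, rfl⟩
    exact (φ.le_opNorm a).trans (mul_le_of_le_one_left (norm_nonneg _) h)
  · intro b hb
    obtain ⟨c, hc, hca⟩ := exists_phase ω a
    refine a.summable.tsum_le_of_sum_le (fun F => ?_)
    have h1 := hb ⟨finFunctional ω F c, ⟨finFunctional_mem F c, finFunctional_norm_le hc⟩, rfl⟩
    simp only [finFunctional_apply, hca] at h1
    rw [← Complex.ofReal_sum, Complex.norm_real] at h1
    exact (le_abs_self _).trans h1

theorem cZero_surjective (Λ : cZero ω →ₗ[ℂ] ℂ)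
    (hbd : ∃ C : ℝ, ∀ φ : cZero ω, ‖Λ φ‖ ≤ C * ‖(φ : StrongDual ℂ (Beurling ω))‖) :
    ∃ a : Beurling ω, ∀ φ : cZero ω, Λ φ = (φ : StrongDual ℂ (Beurling ω)) a := by
  classical
  obtain ⟨C, hC, hΛ⟩ : ∃ C : ℝ, 0 < C ∧ ∀ φ : cZero ω,
      ‖Λ φ‖ ≤ C * ‖(φ : StrongDual ℂ (Beurling ω))‖ := by
    obtain ⟨C, h⟩ := hbd
    exact ⟨max C 1, by positivity, fun φ => (h φ).trans
      (mul_le_mul_of_nonneg_right (le_max_left _ _) (norm_nonneg _))⟩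
  let b : G → ℂ := fun g => Λ ⟨coord ω g, coord_mem_cZero g⟩
  have hfin : ∀ (F : Finset G) (c : G → ℂ),
      Λ ⟨finFunctional ω F c, finFunctional_mem F c⟩ = ∑ g ∈ F, c g * b g := fun F c => by
    have : (⟨finFunctional ω F c, finFunctional_mem F c⟩ : cZero ω) =
        ∑ g ∈ F, c g • ⟨coord ω g, coord_mem_cZero g⟩ := by
      apply Subtype.ext
      simp [finFunctional]
    rw [this, map_sum]
    exact Finset.sum_congr rfl fun g _ => Λ.map_smul _ _
  have hb : Summable fun g => ‖b g‖ * ω g := by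
    obtain ⟨c, hc, hca⟩ := exists_phase ω b
    refine summable_of_sum_le (c := C) (fun g => mul_nonneg (norm_nonneg _) (ω.nonneg g))
      (fun F => ?_)
    have h1 := hΛ ⟨finFunctional ω F c, finFunctional_mem F c⟩
    rw [hfin] at h1
    simp only [hca] at h1
    rw [← Complex.ofReal_sum, Complex.norm_real] at h1
    refine (le_abs_self _).trans (h1.trans ?_)
    exact mul_le_of_le_one_right hC.le (finFunctional_norm_le hc)
  refine ⟨⟨b, hb⟩, fun φ => ?_⟩
  set a : Beurling ω := ⟨b, hb⟩
  obtain ⟨φ, hφ⟩ := φ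
  rw [← sub_eq_zero, ← norm_eq_zero]
  refine le_antisymm (le_of_forall_pos_le_add fun ε hε => ?_) (norm_nonneg _)
  have hpos : 0 < C + ‖a‖ := add_pos_of_pos_of_nonneg hC (norm_nonneg _)
  have hη : 0 < ε / (C + ‖a‖) := div_pos hε hpos
  have h1 := Metric.tendsto_nhds.1 (mem_cZero.1 hφ) _ hη
  rw [Filter.eventually_cofinite] at h1
  let F := h1.toFinset
  let c : G → ℂ := fun g => φ (delta ω g)
  have h2 : ‖φ - finFunctional ω F c‖ ≤ ε / (C + ‖a‖) := by
    refine norm_functional_le hη.le (fun g => ?_)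
    rw [sub_apply, finFunctional_delta]
    split_ifs with hg
    · simpa [c] using mul_nonneg hη.le (ω.nonneg g)
    · have h3 : ‖φ (delta ω g)‖ / ω g < ε / (C + ‖a‖) := by
        by_contra h
        apply hg
        rw [Set.Finite.mem_toFinset, Set.mem_ofPred_eq, Real.dist_0_eq_abs,
          abs_of_nonneg (div_nonneg (norm_nonneg _) (ω.nonneg g))]
        exact h
      rw [sub_zero]
      exact ((div_lt_iff₀ (ω.pos g)).1 h3).le
  have hsub : φ - finFunctional ω F c ∈ cZero ω :=
    (cZero ω).sub_mem hφ (finFunctional_mem F c)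
  have h8 : Λ ⟨φ, hφ⟩ = Λ ⟨φ - finFunctional ω F c, hsub⟩ + ∑ g ∈ F, c g * b g := by
    rw [← hfin, ← Λ.map_add]
    exact congrArg Λ (Subtype.ext (sub_add_cancel φ (finFunctional ω F c)).symm)
  have h4 : ‖Λ ⟨φ, hφ⟩ - ∑ g ∈ F, c g * b g‖ ≤ C * ‖φ - finFunctional ω F c‖ := by
    rw [h8, add_sub_cancel_right]
    exact hΛ ⟨φ - finFunctional ω F c, hsub⟩
  have h5 := (φ - finFunctional ω F c).le_opNorm a
  rw [sub_apply, finFunctional_apply] at h5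
  have h7 : Λ ⟨φ, hφ⟩ - φ a = (Λ ⟨φ, hφ⟩ - ∑ g ∈ F, c g * b g) - (φ a - ∑ g ∈ F, c g * b g) := by
    ring
  change ‖Λ ⟨φ, hφ⟩ - φ a‖ ≤ 0 + ε
  rw [h7, zero_add]
  calc _ ≤ ‖Λ ⟨φ, hφ⟩ - ∑ g ∈ F, c g * b g‖ + ‖φ a - ∑ g ∈ F, c g * b g‖ := norm_sub_le _ _
    _ ≤ C * (ε / (C + ‖a‖)) + (ε / (C + ‖a‖)) * ‖a‖ :=
        add_le_add (h4.trans (mul_le_mul_of_nonneg_left h2 hC.le))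
          (h5.trans (mul_le_mul_of_nonneg_right h2 (norm_nonneg _)))
    _ = ε := by field_simp

/-- `ℓ¹(G, ω)` is a dual Banach algebra with predual `c₀(G, 1/ω)`. -/
def predual (ω : Weight G) : Predual (Beurling ω) where
  carrier := cZero ω
  isClosed := isClosed_cZero
  left_mem := cZero_left_mem
  right_mem := cZero_right_mem
  isometric := cZero_isometric
  surjective := cZero_surjective

end Beurling

/-! ### Pointwise `ω`-amenability of groups -/

/-- `ℓ^∞(G)`. -/
abbrev LInf (G : Type u) : Type u := lp (fun _ : G => ℂ) ⊤

namespace Weight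

variable {G : Type u} [Group G]

/-- `Ω(g, h) = ω(gh) / (ω(g) ω(h))`. -/
def Om (ω : Weight G) (g h : G) : ℝ := ω (g * h) / (ω g * ω h)

theorem Om_nonneg (ω : Weight G) (g h : G) : 0 ≤ ω.Om g h :=
  div_nonneg (ω.nonneg _) (mul_nonneg (ω.nonneg _) (ω.nonneg _))

theorem Om_le_one (ω : Weight G) (g h : G) : ω.Om g h ≤ 1 :=
  div_le_one_of_le₀ (ω.mul_le g h) (mul_nonneg (ω.nonneg _) (ω.nonneg _))

/-- The family `(Ω(g, g⁻¹))_g`. -/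
def omDiag (ω : Weight G) : LInf G :=
  ⟨fun g => (ω.Om g g⁻¹ : ℂ), memℓp_infty ⟨1, by
    rintro _ ⟨g, rfl⟩
    simpa [abs_of_nonneg (ω.Om_nonneg g g⁻¹)] using ω.Om_le_one g g⁻¹⟩⟩

theorem J_bound (ω : Weight G) (h : G) (f : LInf G) (g : G) :
    ‖f (h * g) * ω.Om h g * ω h * ω.Om g⁻¹ h⁻¹ * ω h⁻¹‖ ≤ ω h * ω h⁻¹ * ‖f‖ := by
  simp only [norm_mul, Complex.norm_real, Real.norm_of_nonneg (ω.Om_nonneg _ _),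
    Real.norm_of_nonneg (ω.nonneg _)]
  have h1 : ‖f (h * g)‖ ≤ ‖f‖ := lp.norm_apply_le_norm ENNReal.top_ne_zero f (h * g)
  have h2 := ω.nonneg h
  have h3 := ω.nonneg h⁻¹
  calc _ ≤ ‖f‖ * 1 * ω h * 1 * ω h⁻¹ := by
        gcongr
        all_goals first | exact ω.Om_nonneg _ _ | exact ω.Om_le_one _ _
    _ = _ := by ring

/-- The operator `J_h(f) = (f_{hg} Ω(h,g) ω(h) Ω(g⁻¹,h⁻¹) ω(h⁻¹))_g` on `ℓ^∞(G)`. -/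
def J (ω : Weight G) (h : G) : LInf G →L[ℂ] LInf G :=
  LinearMap.mkContinuous
    { toFun := fun f => ⟨fun g => f (h * g) * ω.Om h g * ω h * ω.Om g⁻¹ h⁻¹ * ω h⁻¹,
        memℓp_infty ⟨ω h * ω h⁻¹ * ‖f‖, by
          rintro _ ⟨g, rfl⟩
          exact ω.J_bound h f g⟩⟩
      map_add' := fun f k => by
        ext g
        simp only [lp.coeFn_add, Pi.add_apply]
        ring
      map_smul' := fun c f => by
        ext g
        simp only [lp.coeFn_smul, Pi.smul_apply, smul_eq_mul, RingHom.id_apply]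
        ring }
    (ω h * ω h⁻¹)
    (fun f => lp.norm_le_of_forall_le
      (mul_nonneg (mul_nonneg (ω.nonneg _) (ω.nonneg _)) (norm_nonneg _)) (ω.J_bound h f))

theorem J_apply (ω : Weight G) (h : G) (f : LInf G) (g : G) :
    ω.J h f g = f (h * g) * ω.Om h g * ω h * ω.Om g⁻¹ h⁻¹ * ω h⁻¹ := rfl

/-- `G` is pointwise `ω`-amenable at `h`: some `N ∈ ℓ^∞(G)^*` satisfies
`⟨(Ω(g, g⁻¹))_g, N⟩ = 1` and `J_h^*(N) = N`. -/
def PointwiseAmenableGroupAt (ω : Weight G) (h : G) : Prop :=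
  ∃ N : StrongDual ℂ (LInf G), N ω.omDiag = 1 ∧ N ∘L ω.J h = N

/-- `G` is pointwise `ω`-amenable. -/
def PointwiseAmenableGroup (ω : Weight G) : Prop := ∀ h : G, ω.PointwiseAmenableGroupAt h

end Weight

end

/-! (1)⇒(2) only shrinks the class of derivations to be tested. The other two implications rest on
one remark: multiplication by `ω g * ω g⁻¹` turns `J_h` into the plain translation `F ↦ F(h ·)`
(`Weight.J_apply_eq`) and turns `omDiag` into the constant function `ω 1`. A pointwise `ω`-amenable
group thus carries, for each single `h`, a functional fixed by translation by `h` and normalised on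
constants.

(2)⇒(3): the universal derivation is `a ↦ da = 1 ⊗ a` on the module of differentials `b dc = b ⊗ c`,
where `(b dc) a = b d(ca) - bc da`. Dually, bilinear forms on `A` carry the actions of
`BanachBimodule.bilinear`, and `a ↦ (T ↦ T 1 a)` is a derivation into the dual. This bimodule need
not be normal, so it is cut down to the closed invariant subspace `Predual.bilinearPart`, on which
everything is `w*`-continuous. That subspace must be large enough: it contains every form supported
on an antidiagonal `g k = m` (`antidiagonal_mem_bilinearPart`), because each value of `a · T` or `T
· a` at a pair of point masses involves only one coefficient of `a`. Taking `m = h`, the actions of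
`δ_h` move the support to `g k = 1`, where forms are parametrised by `ℓ^∞(G)`. The right action
produces `J_h f`, the left action produces `f` minus a multiple of `omDiag`, and innerness at `δ_h`
becomes the invariance of a functional on `ℓ^∞(G)`.

(3)⇒(4): a derivation `D` is averaged over its orbit `D(δ_g) · δ_{g⁻¹}`, with the invariant
functional as the mean. The derivation identity for `δ_h δ_g` shows that translation by `h` changes
the orbit by a constant given by `D(δ_h)` (`J_orbitMap`). As bimodules need not be unital,
`IsDerivation.isInnerAt_of_unit` treats the parts on which the unit acts degenerately. -/

noncomputable section

namespace BanachBimodule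

/-! ### Derivations of a unital algebra into a non-unital bimodule -/

section Unit

variable {A : Type u} [NormedRing A] [NormedAlgebra ℂ A]
variable {X : Type w} [NormedAddCommGroup X] [NormedSpace ℂ X]

/-- For a unital algebra it suffices to implement a derivation at `a` on the part of the bimodule
on which the unit acts as the identity. -/
theorem IsDerivation.isInnerAt_of_unit {B : BanachBimodule A X} {D : A →L[ℂ] X}
    (hD : B.IsDerivation D) {a : A} {φ : X}
    (h : B.right 1 (D a) = B.right a φ - B.left a (B.right 1 φ)) : B.IsInnerAt D a := by
  have h1 : D 1 = B.right 1 (D 1) + B.left 1 (D 1) := by simpa using hD 1 1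
  have h2 : D a = B.right 1 (D a) + B.left a (D 1) := by simpa using hD a 1
  have h3 : D a = B.right a (D 1) + B.left 1 (D a) := by simpa using hD 1 a
  -- `D 1` has no component in the corner where the unit acts as the identity on both sides.
  have h4 : B.left 1 (B.right 1 (D 1)) = 0 := by
    have := congrArg (B.left 1) h1
    rw [map_add, ← B.left_mul, one_mul] at this
    simpa using this
  have h5 : B.left a (B.right 1 (D 1)) = 0 := by
    have := B.left_mul a 1 (B.right 1 (D 1))
    rwa [h4, mul_one, map_zero] at this
  have h6 : B.right a (B.left 1 (D 1)) = 0 := by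
    have := B.right_mul 1 a (D 1)
    rw [one_mul] at this
    rw [B.left_right, this, ← B.left_right, h4, map_zero]
  have h7 : B.left 1 (D a) = B.left 1 (B.right a φ) - B.left a (B.right 1 φ) + B.left a (D 1) := by
    have := congrArg (B.left 1) h2
    rwa [map_add, h, map_sub, ← B.left_mul, ← B.left_mul, one_mul] at this
  have l1 (y : X) : B.left a (B.left 1 y) = B.left a y := by rw [← B.left_mul, mul_one]
  have r1 (y : X) : B.right a (B.right 1 y) = B.right a y := by rw [← B.right_mul, one_mul]
  -- The projections `B.left 1` and `B.right 1` commute and split the bimodule into corners. On the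
  -- one-sided corners `D 1`, with the appropriate sign, implements `D`; on the two-sided corner
  -- `-φ` does, the sign reflecting the order of the difference in `h`.
  refine ⟨B.left 1 (D 1) - B.right 1 (D 1) - B.left 1 (B.right 1 φ), ?_⟩
  simp only [map_sub, l1, r1, h5, h6, B.left_right 1 a (B.right 1 φ)]
  rw [h3, h7]
  abel

end Unit

/-! ### Subbimodules and transport of structure -/

section Restrict

variable {A : Type u} [NonUnitalNormedRing A] [NormedSpace ℂ A]
variable {X : Type w} [NormedAddCommGroup X] [NormedSpace ℂ X]

/-- The restriction of a Banach bimodule structure to an invariant subspace. -/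
def restrict (B : BanachBimodule A X) (S : Submodule ℂ X)
    (hl : ∀ a, ∀ x ∈ S, B.left a x ∈ S) (hr : ∀ a, ∀ x ∈ S, B.right a x ∈ S) :
    BanachBimodule A S where
  left := LinearMap.mkContinuous₂ (LinearMap.mk₂ ℂ (fun a x => ⟨B.left a x, hl a x x.2⟩)
      (fun _ _ _ => Subtype.ext (by simp)) (fun _ _ _ => Subtype.ext (by simp))
      (fun _ _ _ => Subtype.ext (by simp)) (fun _ _ _ => Subtype.ext (by simp)))
    ‖B.left‖ fun a x => B.left.le_opNorm₂ a x
  right := LinearMap.mkContinuous₂ (LinearMap.mk₂ ℂ (fun a x => ⟨B.right a x, hr a x x.2⟩)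
      (fun _ _ _ => Subtype.ext (by simp)) (fun _ _ _ => Subtype.ext (by simp))
      (fun _ _ _ => Subtype.ext (by simp)) (fun _ _ _ => Subtype.ext (by simp)))
    ‖B.right‖ fun a x => B.right.le_opNorm₂ a x
  left_mul a b x := Subtype.ext (B.left_mul a b x)
  right_mul a b x := Subtype.ext (B.right_mul a b x)
  left_right a b x := Subtype.ext (B.left_right a b x)

variable {Y : Type v} [NormedAddCommGroup Y] [NormedSpace ℂ Y]

/-- Transport of a Banach bimodule structure along a continuous linear equivalence. -/
def congr (B : BanachBimodule A X) (e : Y ≃L[ℂ] X) : BanachBimodule A Y where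
  left := (e.symm.conjContinuousAlgEquiv : (X →L[ℂ] X) →L[ℂ] Y →L[ℂ] Y) ∘L B.left
  right := (e.symm.conjContinuousAlgEquiv : (X →L[ℂ] X) →L[ℂ] Y →L[ℂ] Y) ∘L B.right
  left_mul a b x := by simp [B.left_mul]
  right_mul a b x := by simp [B.right_mul]
  left_right a b x := by simp [B.left_right]

end Restrict

/-! ### Bilinear forms as the dual of the module of differentials -/

section Bilinear

variable (A : Type u) [NormedRing A] [NormedAlgebra ℂ A]

/-- The bounded bilinear forms on `A` with the actions
`(a · T)(b, c) = T(b, ca) - T(bc, a)` and `(T · a)(b, c) = T(ab, c)`. -/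
def bilinear : BanachBimodule A (A →L[ℂ] A →L[ℂ] ℂ) where
  left := LinearMap.mkContinuous₂ (LinearMap.mk₂ ℂ
      (fun a T => (ContinuousLinearMap.compL ℂ A A ℂ).flip ((ContinuousLinearMap.mul ℂ A).flip a) ∘L T
        - ContinuousLinearMap.compL ℂ A A ℂ (T.flip a) ∘L ContinuousLinearMap.mul ℂ A)
      (fun _ _ _ => by ext; simp; ring) (fun _ _ _ => by ext; simp; ring)
      (fun _ _ _ => by ext; simp; ring) (fun _ _ _ => by ext; simp; ring))
    2 fun a T => by
      refine ContinuousLinearMap.opNorm_le_bound₂ _ (by positivity) fun b c => ?_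
      have h1 : ‖T b (c * a)‖ ≤ ‖T‖ * ‖b‖ * (‖c‖ * ‖a‖) :=
        (T.le_opNorm₂ _ _).trans (by gcongr; exact norm_mul_le c a)
      have h2 : ‖T (b * c) a‖ ≤ ‖T‖ * (‖b‖ * ‖c‖) * ‖a‖ :=
        (T.le_opNorm₂ _ _).trans (by gcongr; exact norm_mul_le b c)
      change ‖T b (c * a) - T (b * c) a‖ ≤ _
      refine (norm_sub_le _ _).trans ((add_le_add h1 h2).trans_eq ?_)
      ring
  right := LinearMap.mkContinuous₂ (LinearMap.mk₂ ℂ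
      (fun a T => T ∘L ContinuousLinearMap.mul ℂ A a)
      (fun _ _ _ => by ext; simp) (fun _ _ _ => by ext; simp)
      (fun _ _ _ => by ext; simp) (fun _ _ _ => by ext; simp))
    1 fun a T => by
      refine ContinuousLinearMap.opNorm_le_bound₂ _ (by positivity) fun b c => ?_
      change ‖T (a * b) c‖ ≤ _
      refine (T.le_opNorm₂ _ _).trans ?_
      calc _ ≤ ‖T‖ * (‖a‖ * ‖b‖) * ‖c‖ := by gcongr; exact norm_mul_le a b
        _ = _ := by ring
  left_mul a b T := by
    ext c d
    change T c (d * (a * b)) - T (c * d) (a * b) =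
      (T c (d * a * b) - T (c * (d * a)) b) - (T (c * d) (a * b) - T (c * d * a) b)
    simp only [mul_assoc]
    ring
  right_mul a b T := by
    ext c d
    change T (a * b * c) d = T (a * (b * c)) d
    rw [mul_assoc]
  left_right a b T := by
    ext c d
    change T (b * c) (d * a) - T (b * c * d) a = T (b * c) (d * a) - T (b * (c * d)) a
    rw [mul_assoc b]

variable {A}

theorem bilinear_left_apply (a b c : A) (T : A →L[ℂ] A →L[ℂ] ℂ) :
    (bilinear A).left a T b c = T b (c * a) - T (b * c) a := rfl

theorem bilinear_right_apply (a b c : A) (T : A →L[ℂ] A →L[ℂ] ℂ) :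
    (bilinear A).right a T b c = T (a * b) c := rfl

end Bilinear

end BanachBimodule

/-! ### The `w*`-continuous part of the bilinear forms -/

section Universe

variable {A : Type u} [NormedRing A] [NormedAlgebra ℂ A] (P : Predual A)

theorem Predual.continuous_of_mem {φ : StrongDual ℂ A} (hφ : φ ∈ P.carrier) :
    @Continuous A ℂ P.weakStar inferInstance φ :=
  @Continuous.comp A (P.carrier → ℂ) ℂ P.weakStar _ _ (fun a ψ => ψ.1 a) _
    (continuous_apply (⟨φ, hφ⟩ : P.carrier)) continuous_induced_dom

/-- Passing to `ULift` makes the property descend to smaller universes. It is needed because the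
bimodule of bilinear forms lives in the universe of the algebra, whereas amenability may be assumed
for bimodules in a larger one. -/
theorem PointwiseConnesAmenableAt.lift {a : A}
    (h : PointwiseConnesAmenableAt.{u, max w v} P a) : PointwiseConnesAmenableAt.{u, w} P a := by
  intro X _ _ _ B hB D hD hc
  let e : ULift.{v} X ≃L[ℂ] X := ContinuousLinearEquiv.ulift
  obtain ⟨x, hx⟩ := h (ULift.{v} X) (B.congr e)
    (fun φ => by
      simp only [Predual.wStarContinuous_iff]
      have := hB (φ ∘L (e.symm : X →L[ℂ] ULift.{v} X))
      simp only [Predual.wStarContinuous_iff] at this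
      exact ⟨fun x => this.1 (e x), fun x => this.2 (e x)⟩)
    ((ContinuousLinearMap.compL ℂ (ULift.{v} X) X ℂ).flip (e : ULift.{v} X →L[ℂ] X) ∘L D)
    (fun a b => by
      ext x
      exact DFunLike.congr_fun (hD a b) (e x))
    (by
      rw [Predual.wStarContinuous_iff] at hc ⊢
      exact fun x => hc (e x))
  refine ⟨x ∘L (e.symm : X →L[ℂ] ULift.{v} X), ?_⟩
  ext y
  exact DFunLike.congr_fun hx (e.symm y)

/-- The bounded bilinear forms `T` on a dual Banach algebra for which the functionals
`a ↦ F (a · T)`, `a ↦ F (T · a)`, for `F` in the dual space, and `T b` belong to the predual. -/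
def Predual.bilinearPart : Submodule ℂ (A →L[ℂ] A →L[ℂ] ℂ) where
  carrier := {T | (∀ F : StrongDual ℂ (A →L[ℂ] A →L[ℂ] ℂ),
    F ∘L (BanachBimodule.bilinear A).left.flip T ∈ P.carrier ∧
    F ∘L (BanachBimodule.bilinear A).right.flip T ∈ P.carrier) ∧ ∀ b, T b ∈ P.carrier}
  zero_mem' := by simp
  add_mem' {T S} hT hS := by
    refine ⟨fun F => ⟨?_, ?_⟩, fun b => P.carrier.add_mem (hT.2 b) (hS.2 b)⟩
    · convert P.carrier.add_mem (hT.1 F).1 (hS.1 F).1 using 1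
      ext; simp
    · convert P.carrier.add_mem (hT.1 F).2 (hS.1 F).2 using 1
      ext; simp
  smul_mem' c T hT := by
    refine ⟨fun F => ⟨?_, ?_⟩, fun b => P.carrier.smul_mem c (hT.2 b)⟩
    · convert P.carrier.smul_mem c (hT.1 F).1 using 1
      ext a
      exact (congrArg F (((BanachBimodule.bilinear A).left a).map_smul c T)).trans (F.map_smul c _)
    · convert P.carrier.smul_mem c (hT.1 F).2 using 1
      ext a
      exact (congrArg F (((BanachBimodule.bilinear A).right a).map_smul c T)).trans (F.map_smul c _)

/-- Each defining condition is the preimage of the closed predual under a map continuous in `T`.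
Closedness makes the subspace a Banach space, hence an admissible bimodule. -/
theorem Predual.isClosed_bilinearPart :
    IsClosed (P.bilinearPart : Set (A →L[ℂ] A →L[ℂ] ℂ)) := by
  have : (P.bilinearPart : Set (A →L[ℂ] A →L[ℂ] ℂ)) =
      (⋂ F : StrongDual ℂ (A →L[ℂ] A →L[ℂ] ℂ),
        (fun T => F ∘L (BanachBimodule.bilinear A).left.flip T) ⁻¹' P.carrier ∩
        (fun T => F ∘L (BanachBimodule.bilinear A).right.flip T) ⁻¹' P.carrier) ∩
      ⋂ b, (fun T : A →L[ℂ] A →L[ℂ] ℂ => T b) ⁻¹' P.carrier := by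
    ext T
    simp [Predual.bilinearPart]
  rw [this]
  refine (isClosed_iInter fun F => (P.isClosed.preimage ?_).inter (P.isClosed.preimage ?_)).inter
    (isClosed_iInter fun b => P.isClosed.preimage ?_)
  · exact (ContinuousLinearMap.compL ℂ A _ ℂ F ∘L
      (BanachBimodule.bilinear A).left.flip).continuous
  · exact (ContinuousLinearMap.compL ℂ A _ ℂ F ∘L
      (BanachBimodule.bilinear A).right.flip).continuous
  · fun_prop

/-- Evaluation of bilinear forms. -/
def bilinearEval (b c : A) : StrongDual ℂ (A →L[ℂ] A →L[ℂ] ℂ) :=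
  ContinuousLinearMap.apply ℂ ℂ c ∘L ContinuousLinearMap.apply ℂ (A →L[ℂ] ℂ) b

/-- Acting on the same side translates the functional within the predual, which is a submodule.
Acting on the opposite side commutes past `a`, which is then absorbed into `F`; this is why the
definition quantifies over all `F`. -/
theorem Predual.left_mem_bilinearPart (a : A) {T : A →L[ℂ] A →L[ℂ] ℂ} (hT : T ∈ P.bilinearPart) :
    (BanachBimodule.bilinear A).left a T ∈ P.bilinearPart := by
  refine ⟨fun F => ⟨?_, ?_⟩, fun b => ?_⟩
  · convert P.left_mem a _ (hT.1 F).1 using 1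
    ext c
    exact congrArg F ((BanachBimodule.bilinear A).left_mul c a T).symm
  · convert (hT.1 (F ∘L (BanachBimodule.bilinear A).left a)).2 using 1
    ext c
    exact congrArg F ((BanachBimodule.bilinear A).left_right a c T)
  -- The subtracted term `c ↦ T (b * c) a` is the translate by `b` of `c ↦ (T · c)(1, a)`, so it
  -- lies in the predual by the condition on the right action with `F` the evaluation at `(1, a)`.
  · convert P.carrier.sub_mem (P.left_mem a _ (hT.2 b))
      (P.right_mem b _ (hT.1 (bilinearEval 1 a)).2) using 1
    ext c
    change T b (c * a) - T (b * c) a = T b (c * a) - T (b * c * 1) a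
    rw [mul_one]

theorem Predual.right_mem_bilinearPart (a : A) {T : A →L[ℂ] A →L[ℂ] ℂ} (hT : T ∈ P.bilinearPart) :
    (BanachBimodule.bilinear A).right a T ∈ P.bilinearPart := by
  refine ⟨fun F => ⟨?_, ?_⟩, fun b => hT.2 (a * b)⟩
  · convert (hT.1 (F ∘L (BanachBimodule.bilinear A).right a)).1 using 1
    ext c
    exact congrArg F ((BanachBimodule.bilinear A).left_right c a T).symm
  · convert P.right_mem a _ (hT.1 F).2 using 1
    ext c
    exact congrArg F ((BanachBimodule.bilinear A).right_mul a c T).symm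

/-- Pointwise Connes amenability applied to the part of a bimodule on which the actions and a
derivation into the dual are `w*`-continuous. -/
theorem PointwiseConnesAmenableAt.exists_of_invariant {a : A}
    (h : PointwiseConnesAmenableAt.{u, w} P a) {X : Type w} [NormedAddCommGroup X]
    [NormedSpace ℂ X] [CompleteSpace X] (B : BanachBimodule A X) (S : Submodule ℂ X)
    (hS : IsClosed (S : Set X)) (hl : ∀ a, ∀ x ∈ S, B.left a x ∈ S)
    (hr : ∀ a, ∀ x ∈ S, B.right a x ∈ S)
    (hc : ∀ x ∈ S, ∀ F : StrongDual ℂ X,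
      F ∘L B.left.flip x ∈ P.carrier ∧ F ∘L B.right.flip x ∈ P.carrier)
    {D : A →L[ℂ] StrongDual ℂ X} (hD : B.dual.IsDerivation D)
    (hDc : ∀ x ∈ S, D.flip x ∈ P.carrier) :
    ∃ F : StrongDual ℂ X, ∀ x ∈ S, D a x = F (B.right a x) - F (B.left a x) := by
  -- By Hahn–Banach, conditions on functionals of `X` control all functionals of `S`. The same
  -- extension carries the implementing functional back to `X`.
  have key (φ : StrongDual ℂ S) : ∃ F : StrongDual ℂ X, ∀ x : S, F x = φ x := by
    obtain ⟨F, hF, -⟩ := exists_extension_norm_eq S φ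
    exact ⟨F, hF⟩
  have : CompleteSpace S := hS.completeSpace_coe
  obtain ⟨φ, hφ⟩ := h S (B.restrict S hl hr) (fun φ => by
      obtain ⟨F, hF⟩ := key φ
      simp only [Predual.wStarContinuous_iff]
      refine ⟨fun x => ?_, fun x => ?_⟩
      · convert P.continuous_of_mem (hc x x.2 F).2 using 1
        ext c
        exact (hF _).symm
      · convert P.continuous_of_mem (hc x x.2 F).1 using 1
        ext c
        exact (hF _).symm)
    ((ContinuousLinearMap.compL ℂ S X ℂ).flip S.subtypeL ∘L D)
    (fun b c => by
      ext x
      exact DFunLike.congr_fun (hD b c) (x : X))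
    ((P.wStarContinuous_iff _).2 fun x => P.continuous_of_mem (hDc x x.2))
  obtain ⟨F, hF⟩ := key φ
  refine ⟨F, fun x hx => ?_⟩
  have := DFunLike.congr_fun hφ ⟨x, hx⟩
  exact this.trans (congrArg₂ (· - ·) (hF _).symm (hF _).symm)

/-- The functional that pointwise Connes amenability yields on bilinear forms. -/
theorem PointwiseConnesAmenableAt.exists_functional {a : A}
    (h : PointwiseConnesAmenableAt.{u, u} P a) :
    ∃ F : StrongDual ℂ (A →L[ℂ] A →L[ℂ] ℂ), ∀ T ∈ P.bilinearPart, T 1 a =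
      F ((BanachBimodule.bilinear A).right a T) - F ((BanachBimodule.bilinear A).left a T) :=
  h.exists_of_invariant P (BanachBimodule.bilinear A) P.bilinearPart P.isClosed_bilinearPart
    (fun a _ => P.left_mem_bilinearPart a) (fun a _ => P.right_mem_bilinearPart a)
    (fun _ hT => hT.1)
    (D := (ContinuousLinearMap.apply ℂ (A →L[ℂ] ℂ) (1 : A)).flip)
    (fun b c => by
      ext T
      -- The correction term of the left action cancels the contribution of the right action.
      change T 1 (b * c) = (T 1 (b * c) - T (1 * b) c) + T (b * 1) c
      simp)
    (fun _ hT => hT.2 1)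

end Universe

theorem PointwiseAmenable.pointwiseConnesAmenable {A : Type u} [NormedRing A] [NormedAlgebra ℂ A]
    (P : Predual A) (h : PointwiseAmenable.{u, w} A) : PointwiseConnesAmenable.{u, w} P :=
  fun a X _ _ _ B _ D hD _ => h a X B D hD

/-! ### `J_h` as a conjugate of translation -/

namespace Weight

variable {G : Type u} [Group G] (ω : Weight G)

theorem ofReal_ne_zero (g : G) : (ω g : ℂ) ≠ 0 := by exact_mod_cast (ω.pos g).ne'

theorem omDiag_apply (g : G) : ω.omDiag g = ω 1 / (ω g * ω g⁻¹) := by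
  change ((ω.Om g g⁻¹ : ℝ) : ℂ) = _
  simp [Om]

/-- The factors `ω h` and `ω h⁻¹` cancel against the denominators of `Om`. With `s g = ω g * ω g⁻¹`
this says `s · J_h f = (s f)(h ·)`. -/
theorem J_apply_eq (h : G) (f : LInf G) (g : G) :
    ω.J h f g = f (h * g) * (ω (h * g) * ω (h * g)⁻¹) / (ω g * ω g⁻¹) := by
  have h1 := ω.ofReal_ne_zero g
  have h2 := ω.ofReal_ne_zero g⁻¹
  have h3 := ω.ofReal_ne_zero h
  have h4 := ω.ofReal_ne_zero h⁻¹
  rw [J_apply, mul_inv_rev]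
  simp only [Om, Complex.ofReal_div, Complex.ofReal_mul]
  field_simp

/-- Multiplied by `ω g * ω g⁻¹`, `omDiag` becomes the constant `ω 1`, which translation fixes. -/
theorem J_omDiag (h : G) : ω.J h ω.omDiag = ω.omDiag := by
  ext g
  rw [J_apply_eq, omDiag_apply, omDiag_apply,
    div_mul_cancel₀ _ (mul_ne_zero (ω.ofReal_ne_zero _) (ω.ofReal_ne_zero _))]

/-- The bounded function `F(g) / (ω(g) ω(g⁻¹))`. -/
def divSymm (F : G → ℂ) (C : ℝ) (hF : ∀ g, ‖F g‖ ≤ C * (ω g * ω g⁻¹)) : LInf G :=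
  ⟨fun g => F g / (ω g * ω g⁻¹), memℓp_infty ⟨C, by
    rintro _ ⟨g, rfl⟩
    simp only [norm_div, norm_mul, Complex.norm_real, Real.norm_of_nonneg (ω.nonneg _)]
    exact (div_le_iff₀ (mul_pos (ω.pos g) (ω.pos g⁻¹))).2 (hF g)⟩⟩

theorem divSymm_apply (F : G → ℂ) (C : ℝ) (hF : ∀ g, ‖F g‖ ≤ C * (ω g * ω g⁻¹)) (g : G) :
    ω.divSymm F C hF g = F g / (ω g * ω g⁻¹) := rfl

theorem norm_divSymm_le {F : G → ℂ} {C : ℝ} (hC : 0 ≤ C)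
    (hF : ∀ g, ‖F g‖ ≤ C * (ω g * ω g⁻¹)) : ‖ω.divSymm F C hF‖ ≤ C :=
  lp.norm_le_of_forall_le hC fun g => by
    simp only [divSymm_apply, norm_div, norm_mul, Complex.norm_real,
      Real.norm_of_nonneg (ω.nonneg _)]
    exact (div_le_iff₀ (mul_pos (ω.pos g) (ω.pos g⁻¹))).2 (hF g)

theorem J_divSymm (h : G) (F : G → ℂ) (C : ℝ) (hF : ∀ g, ‖F g‖ ≤ C * (ω g * ω g⁻¹)) (g : G) :
    ω.J h (ω.divSymm F C hF) g = F (h * g) / (ω g * ω g⁻¹) := by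
  rw [J_apply_eq, divSymm_apply,
    div_mul_cancel₀ _ (mul_ne_zero (ω.ofReal_ne_zero _) (ω.ofReal_ne_zero _))]

end Weight

namespace Beurling

variable {G : Type u} [Group G] {ω : Weight G}

/-! ### Bounded maps determined by point masses -/

section Lift

variable {V : Type w} [NormedAddCommGroup V] [NormedSpace ℂ V]

theorem opNorm_le_of_delta {S : Beurling ω →L[ℂ] V} {C : ℝ} (hC : 0 ≤ C)
    (H : ∀ g, ‖S (delta ω g)‖ ≤ C * ω g) : ‖S‖ ≤ C := by
  refine S.opNorm_le_bound hC (fun f => ?_)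
  have h1 := (hasSum_delta f).mapL S
  simp only [map_smul] at h1
  rw [← h1.tsum_eq, norm_def, ← tsum_mul_left]
  refine tsum_of_norm_bounded (f.summable.mul_left C).hasSum (fun g => ?_)
  rw [norm_smul]
  calc _ ≤ ‖f g‖ * (C * ω g) := mul_le_mul_of_nonneg_left (H g) (norm_nonneg _)
    _ = _ := by ring

theorem opNorm_le_of_delta₂ {S : Beurling ω →L[ℂ] Beurling ω →L[ℂ] V} {C : ℝ} (hC : 0 ≤ C)
    (H : ∀ g h, ‖S (delta ω g) (delta ω h)‖ ≤ C * ω g * ω h) : ‖S‖ ≤ C :=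
  opNorm_le_of_delta hC fun g => opNorm_le_of_delta (mul_nonneg hC (ω.nonneg g)) (H g)

variable [CompleteSpace V]

theorem summable_lift {v : G → V} {C : ℝ} (hv : ∀ g, ‖v g‖ ≤ C * ω g) (f : Beurling ω) :
    Summable fun g => f g • v g := by
  refine Summable.of_norm_bounded (f.summable.mul_left C) fun g => ?_
  rw [norm_smul]
  calc _ ≤ ‖f g‖ * (C * ω g) := mul_le_mul_of_nonneg_left (hv g) (norm_nonneg _)
    _ = _ := by ring

/-- The bounded linear map on `ℓ¹(G, ω)` with prescribed values at the point masses. -/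
def lift (v : G → V) (C : ℝ) (hv : ∀ g, ‖v g‖ ≤ C * ω g) : Beurling ω →L[ℂ] V :=
  LinearMap.mkContinuous
    { toFun := fun f => ∑' g, f g • v g
      map_add' := fun f h => by
        simp only [add_apply, add_smul]
        exact (summable_lift hv f).tsum_add (summable_lift hv h)
      map_smul' := fun c f => by
        simp only [smul_apply, mul_smul, RingHom.id_apply]
        exact (summable_lift hv f).tsum_const_smul c } C fun f => by
    rw [norm_def, ← tsum_mul_left]
    refine tsum_of_norm_bounded (f.summable.mul_left C).hasSum (fun g => ?_)
    rw [norm_smul]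
    calc _ ≤ ‖f g‖ * (C * ω g) := mul_le_mul_of_nonneg_left (hv g) (norm_nonneg _)
      _ = _ := by ring

theorem lift_delta (v : G → V) (C : ℝ) (hv : ∀ g, ‖v g‖ ≤ C * ω g) (g : G) :
    lift v C hv (delta ω g) = v g := by
  change ∑' x, delta ω g x • v x = v g
  rw [tsum_eq_single g fun x hx => by simp [delta_apply, hx]]
  simp [delta_apply]

end Lift

theorem delta_mul_apply (h : G) (a : Beurling ω) (x : G) : (delta ω h * a) x = a (h⁻¹ * x) := by
  rw [mul_apply, tsum_eq_single h fun y hy => by simp [delta_apply, hy]]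
  simp [delta_apply]

theorem mul_delta_apply (a : Beurling ω) (h x : G) : (a * delta ω h) x = a (x * h⁻¹) := by
  rw [mul_apply, tsum_eq_single (x * h⁻¹)]
  · simp [delta_apply]
  · intro y hy
    have : y⁻¹ * x ≠ h := fun H => hy (by rw [← H]; group)
    simp [delta_apply, this]

/-- A functional of a bounded linear map that is controlled by the weighted supremum norm belongs
to `c₀(G, 1/ω)`. -/
theorem comp_mem_cZero {V : Type w} [NormedAddCommGroup V] [NormedSpace ℂ V]
    {L : Beurling ω →L[ℂ] V} {C : ℝ}
    (hL : ∀ a : Beurling ω, (∀ k, ‖a k‖ * ω k ≤ 1) → ‖L a‖ ≤ C) (φ : StrongDual ℂ V) :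
    φ ∘L L ∈ cZero ω := by
  classical
  obtain ⟨c, hc, hca⟩ := exists_phase ω fun k => φ (L (delta ω k))
  have hs : Summable fun k => ‖φ (L (delta ω k))‖ / ω k := by
    refine summable_of_sum_le (c := ‖φ‖ * C) (fun k => div_nonneg (norm_nonneg _) (ω.nonneg k))
      fun S => ?_
    -- One power of `ω k` normalises the phase and the other makes `‖a k‖ * ω k ≤ 1`, uniformly in
    -- `S`. Then `φ (L a)` is the partial sum itself, so the ratios are summable and in particular
    -- tend to zero.
    let a : Beurling ω := ∑ k ∈ S, (c k / (ω k) ^ 2) • delta ω k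
    have h1 (k : G) : a k = if k ∈ S then c k / (ω k) ^ 2 else 0 := by
      rw [← coord_apply, map_sum]
      simp [delta_apply]
    have h2 : ‖L a‖ ≤ C := hL a fun k => by
      rw [h1]
      split_ifs
      · have := ω.pos k
        rw [norm_div, norm_pow, Complex.norm_real, Real.norm_of_nonneg (ω.nonneg k),
          div_mul_eq_mul_div, div_le_one (by positivity), sq]
        exact mul_le_mul_of_nonneg_right (hc k) this.le
      · simp
    have h3 : φ (L a) = ((∑ k ∈ S, ‖φ (L (delta ω k))‖ / ω k : ℝ) : ℂ) := by
      simp only [a, map_sum, map_smul, smul_eq_mul, Complex.ofReal_sum]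
      refine Finset.sum_congr rfl fun k _ => ?_
      rw [div_mul_eq_mul_div, hca]
      have := ω.ofReal_ne_zero k
      push_cast
      field_simp
    have h4 := φ.le_opNorm (L a)
    rw [h3, Complex.norm_real] at h4
    exact (le_abs_self _).trans (h4.trans (mul_le_mul_of_nonneg_left h2 (norm_nonneg _)))
  exact hs.tendsto_cofinite_zero

theorem norm_coord_le (ω : Weight G) (g : G) : ‖coord ω g‖ ≤ (ω g)⁻¹ :=
  (coord ω g).opNorm_le_bound (inv_nonneg.2 (ω.nonneg g)) fun f => by
    rw [coord_apply, inv_mul_eq_div, le_div_iff₀ (ω.pos g)]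
    exact norm_apply_le f g

/-! ### Bilinear forms supported on an antidiagonal -/

section Antidiagonal

variable {m : G} {F : G → ℂ} {C : ℝ}

/-- The bilinear form with `T(δ_g, δ_k) = F(g)` if `g k = m` and `0` otherwise. -/
def antidiagonal (m : G) (F : G → ℂ) (C : ℝ) (hF : ∀ g, ‖F g‖ ≤ C * (ω g * ω (g⁻¹ * m))) :
    Beurling ω →L[ℂ] Beurling ω →L[ℂ] ℂ :=
  lift (fun g => F g • coord ω (g⁻¹ * m)) C fun g => by
    have := ω.pos (g⁻¹ * m)
    rw [norm_smul]
    calc _ ≤ C * (ω g * ω (g⁻¹ * m)) * (ω (g⁻¹ * m))⁻¹ :=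
          mul_le_mul (hF g) (norm_coord_le ω _) (norm_nonneg _) ((norm_nonneg _).trans (hF g))
      _ = _ := by field_simp

variable (hF : ∀ g, ‖F g‖ ≤ C * (ω g * ω (g⁻¹ * m)))

theorem antidiagonal_delta_left (g : G) (c : Beurling ω) :
    antidiagonal m F C hF (delta ω g) c = F g * c (g⁻¹ * m) := by
  rw [antidiagonal, lift_delta]
  rfl

theorem antidiagonal_delta_right (b : Beurling ω) (k : G) :
    antidiagonal m F C hF b (delta ω k) = F (m * k⁻¹) * b (m * k⁻¹) := by
  classical
  have : (antidiagonal m F C hF).flip (delta ω k) = F (m * k⁻¹) • coord ω (m * k⁻¹) :=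
    clm_ext fun g => by
      rw [ContinuousLinearMap.flip_apply, antidiagonal_delta_left]
      by_cases h : g * k = m
      · subst h
        simp [delta_apply]
      · have h1 : g⁻¹ * m ≠ k := fun H => h (by rw [← H]; group)
        have h2 : m * k⁻¹ ≠ g := fun H => h (by rw [← H]; group)
        simp [delta_apply, h1, h2]
  exact DFunLike.congr_fun this b

theorem norm_mul_le_of_bound {x y : ℂ} {C r s : ℝ} (hC : 0 ≤ C) (hy : ‖y‖ * r ≤ 1)
    (hx : ‖x‖ ≤ C * (s * r)) (hs : 0 ≤ s) : ‖x * y‖ ≤ C * s := by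
  rw [norm_mul]
  calc _ ≤ C * (s * r) * ‖y‖ := mul_le_mul_of_nonneg_right hx (norm_nonneg _)
    _ = C * s * (‖y‖ * r) := by ring
    _ ≤ _ := mul_le_of_le_one_right (mul_nonneg hC hs) hy

theorem antidiagonal_const_nonneg (hF : ∀ g, ‖F g‖ ≤ C * (ω g * ω (g⁻¹ * m))) : 0 ≤ C :=
  nonneg_of_mul_nonneg_left ((norm_nonneg _).trans (hF 1)) (mul_pos (ω.pos _) (ω.pos _))

/-- At `(δ_g, δ_h)` both terms contain the same single coefficient `a ((g * h)⁻¹ * m)`, so a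
weighted supremum bound on `a` suffices in place of its `ℓ¹` norm. Submultiplicativity of `ω`
absorbs the remaining weights. This is the bound that `comp_mem_cZero` requires. -/
theorem norm_left_antidiagonal_le {a : Beurling ω} (ha : ∀ k, ‖a k‖ * ω k ≤ 1) :
    ‖(BanachBimodule.bilinear (Beurling ω)).left a (antidiagonal m F C hF)‖ ≤ C + C := by
  have hC := antidiagonal_const_nonneg hF
  refine opNorm_le_of_delta₂ (add_nonneg hC hC) fun g h => ?_
  rw [BanachBimodule.bilinear_left_apply, delta_mul_delta,
    antidiagonal_delta_left, antidiagonal_delta_left, delta_mul_apply]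
  have e : h⁻¹ * (g⁻¹ * m) = (g * h)⁻¹ * m := by group
  rw [e, add_mul, add_mul]
  refine (norm_sub_le _ _).trans (add_le_add ?_ ?_)
  · rw [mul_assoc]
    refine norm_mul_le_of_bound hC (ha _) ((hF g).trans ?_) (mul_nonneg (ω.nonneg _) (ω.nonneg _))
    refine mul_le_mul_of_nonneg_left ?_ hC
    rw [mul_assoc]
    refine mul_le_mul_of_nonneg_left ?_ (ω.nonneg g)
    simpa [mul_assoc] using ω.mul_le h ((g * h)⁻¹ * m)
  · rw [mul_assoc]
    refine norm_mul_le_of_bound hC (ha _) ((hF (g * h)).trans ?_)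
      (mul_nonneg (ω.nonneg _) (ω.nonneg _))
    exact mul_le_mul_of_nonneg_left
      (mul_le_mul_of_nonneg_right (ω.mul_le g h) (ω.nonneg _)) hC

theorem norm_right_antidiagonal_le {a : Beurling ω} (ha : ∀ k, ‖a k‖ * ω k ≤ 1) :
    ‖(BanachBimodule.bilinear (Beurling ω)).right a (antidiagonal m F C hF)‖ ≤ C := by
  have hC := antidiagonal_const_nonneg hF
  refine opNorm_le_of_delta₂ hC fun g h => ?_
  rw [BanachBimodule.bilinear_right_apply,
    antidiagonal_delta_right, mul_delta_apply, mul_assoc C]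
  refine norm_mul_le_of_bound hC (ha _) ((hF _).trans ?_) (mul_nonneg (ω.nonneg _) (ω.nonneg _))
  refine mul_le_mul_of_nonneg_left ?_ hC
  have h1 : (m * h⁻¹)⁻¹ * m = h := by group
  have h2 : ω (m * h⁻¹) ≤ ω (m * h⁻¹ * g⁻¹) * ω g := by
    simpa using ω.mul_le (m * h⁻¹ * g⁻¹) g
  rw [h1]
  calc _ ≤ ω (m * h⁻¹ * g⁻¹) * ω g * ω h := mul_le_mul_of_nonneg_right h2 (ω.nonneg h)
    _ = _ := by ring

/-- At a point mass the value is a multiple of a coordinate functional; general `b` follows since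
`cZero ω` is closed. -/
theorem antidiagonal_apply_mem (b : Beurling ω) : antidiagonal m F C hF b ∈ cZero ω := by
  have h1 : ∀ g, antidiagonal m F C hF (delta ω g) ∈ cZero ω := fun g => by
    have : antidiagonal m F C hF (delta ω g) = F g • coord ω (g⁻¹ * m) := by
      rw [antidiagonal, lift_delta]
    rw [this]
    exact (cZero ω).smul_mem _ (coord_mem_cZero _)
  have h5 := (hasSum_delta b).mapL (antidiagonal m F C hF)
  exact isClosed_cZero.mem_of_tendsto h5 (Filter.Eventually.of_forall fun F =>
    Submodule.sum_mem _ fun s _ => by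
      rw [map_smul]; exact Submodule.smul_mem _ _ (h1 s))

theorem norm_antidiagonal_le : ‖antidiagonal m F C hF‖ ≤ C := by
  refine opNorm_le_of_delta (antidiagonal_const_nonneg hF) fun g => ?_
  have := ω.pos (g⁻¹ * m)
  rw [antidiagonal, lift_delta, norm_smul]
  calc _ ≤ C * (ω g * ω (g⁻¹ * m)) * (ω (g⁻¹ * m))⁻¹ :=
        mul_le_mul (hF g) (norm_coord_le ω _) (norm_nonneg _) ((norm_nonneg _).trans (hF g))
    _ = _ := by field_simp

end Antidiagonal

theorem mem_bilinearPart_of_bound {T : Beurling ω →L[ℂ] Beurling ω →L[ℂ] ℂ} {C C' : ℝ}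
    (hl : ∀ a : Beurling ω, (∀ k, ‖a k‖ * ω k ≤ 1) →
      ‖(BanachBimodule.bilinear (Beurling ω)).left a T‖ ≤ C)
    (hr : ∀ a : Beurling ω, (∀ k, ‖a k‖ * ω k ≤ 1) →
      ‖(BanachBimodule.bilinear (Beurling ω)).right a T‖ ≤ C')
    (hT : ∀ b, T b ∈ cZero ω) : T ∈ (predual ω).bilinearPart :=
  ⟨fun Φ =>
    ⟨comp_mem_cZero (L := (BanachBimodule.bilinear (Beurling ω)).left.flip T) hl Φ,
      comp_mem_cZero (L := (BanachBimodule.bilinear (Beurling ω)).right.flip T) hr Φ⟩, hT⟩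

theorem antidiagonal_mem_bilinearPart {m : G} {F : G → ℂ} {C : ℝ}
    (hF : ∀ g, ‖F g‖ ≤ C * (ω g * ω (g⁻¹ * m))) :
    antidiagonal m F C hF ∈ (predual ω).bilinearPart :=
  mem_bilinearPart_of_bound (fun _ ha => norm_left_antidiagonal_le hF ha)
    (fun _ ha => norm_right_antidiagonal_le hF ha) (antidiagonal_apply_mem hF)

/-! ### The invariant functional obtained from antidiagonal forms -/

theorem norm_mul_symm_le (ω : Weight G) (f : LInf G) (g : G) :
    ‖f g * (ω g * ω g⁻¹)‖ ≤ ‖f‖ * (ω g * ω (g⁻¹ * 1)) := by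
  rw [mul_one, norm_mul, norm_mul, Complex.norm_real, Complex.norm_real,
    Real.norm_of_nonneg (ω.nonneg _), Real.norm_of_nonneg (ω.nonneg _)]
  exact mul_le_mul_of_nonneg_right (lp.norm_apply_le_norm ENNReal.top_ne_zero f g)
    (mul_nonneg (ω.nonneg _) (ω.nonneg _))

/-- The coefficients used on `g k = 1` are also admissible on `g k = h`, at the cost of a factor `ω
h⁻¹`. -/
theorem norm_mul_symm_le' (ω : Weight G) (f : LInf G) (h g : G) :
    ‖f g * (ω g * ω g⁻¹)‖ ≤ ‖f‖ * ω h⁻¹ * (ω g * ω (g⁻¹ * h)) := by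
  have h1 : ω g⁻¹ ≤ ω (g⁻¹ * h) * ω h⁻¹ := by simpa using ω.mul_le (g⁻¹ * h) h⁻¹
  refine (norm_mul_symm_le ω f g).trans ?_
  rw [mul_one, mul_assoc]
  refine mul_le_mul_of_nonneg_left ?_ (norm_nonneg _)
  calc _ ≤ ω g * (ω (g⁻¹ * h) * ω h⁻¹) := mul_le_mul_of_nonneg_left h1 (ω.nonneg g)
    _ = _ := by ring

/-- The bilinear form with `T(δ_g, δ_k) = f(g) ω(g) ω(g⁻¹)` if `g k = 1` and `0` otherwise,
depending linearly on `f ∈ ℓ^∞(G)`. -/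
def ofLInf (ω : Weight G) : LInf G →L[ℂ] Beurling ω →L[ℂ] Beurling ω →L[ℂ] ℂ :=
  LinearMap.mkContinuous
    { toFun := fun f => antidiagonal 1 (fun g => f g * (ω g * ω g⁻¹)) ‖f‖ (norm_mul_symm_le ω f)
      map_add' := fun f k => clm_ext fun g => by
        ext c
        simp only [_root_.add_apply, antidiagonal_delta_left, lp.coeFn_add,
          Pi.add_apply]
        ring
      map_smul' := fun r f => clm_ext fun g => by
        ext c
        simp only [_root_.smul_apply, antidiagonal_delta_left, lp.coeFn_smul,
          Pi.smul_apply, smul_eq_mul, RingHom.id_apply]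
        ring }
    1 fun f => by
      rw [one_mul]
      exact norm_antidiagonal_le (norm_mul_symm_le ω f)

theorem ofLInf_apply (f : LInf G) : ofLInf ω f =
    antidiagonal 1 (fun g => f g * (ω g * ω g⁻¹)) ‖f‖ (norm_mul_symm_le ω f) := rfl

/-- Since `(T · δ_h)(δ_g, δ_k) = T(δ_{hg}, δ_k)`, the support `g k = h` moves to `g k = 1` and the
coefficients are translated by `h`, which is `J_h` in terms of `f`. -/
theorem right_antidiagonal (h : G) (f : LInf G) :
    (BanachBimodule.bilinear (Beurling ω)).right (delta ω h)
      (antidiagonal h (fun g => f g * (ω g * ω g⁻¹)) _ (norm_mul_symm_le' ω f h)) =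
    ofLInf ω (ω.J h f) := by
  refine clm_ext fun g => ?_
  ext c
  rw [BanachBimodule.bilinear_right_apply, delta_mul_delta, antidiagonal_delta_left, ofLInf_apply,
    antidiagonal_delta_left, ω.J_apply_eq,
    div_mul_cancel₀ _ (mul_ne_zero (ω.ofReal_ne_zero _) (ω.ofReal_ne_zero _))]
  simp

/-- Both `T(δ_g, δ_{kh})` and `T(δ_{gk}, δ_h)` vanish unless `g k = 1`. There the first is the
coefficient at `g` and the second the constant `f 1 * ω 1 * ω 1`; as `omDiag` represents the
constant `ω 1`, the multiple is `f 1 * ω 1`. -/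
theorem left_antidiagonal (h : G) (f : LInf G) :
    (BanachBimodule.bilinear (Beurling ω)).left (delta ω h)
      (antidiagonal h (fun g => f g * (ω g * ω g⁻¹)) _ (norm_mul_symm_le' ω f h)) =
    ofLInf ω (f - (f 1 * ω 1) • ω.omDiag) := by
  classical
  rw [map_sub, map_smul]
  refine clm_ext fun g => clm_ext fun k => ?_
  rw [BanachBimodule.bilinear_left_apply, delta_mul_delta, delta_mul_delta,
    antidiagonal_delta_left, antidiagonal_delta_left]
  simp only [_root_.sub_apply, _root_.smul_apply, smul_eq_mul,
    ofLInf_apply, antidiagonal_delta_left, ω.omDiag_apply, delta_apply,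
    div_mul_cancel₀ _ (mul_ne_zero (ω.ofReal_ne_zero g) (ω.ofReal_ne_zero g⁻¹))]
  by_cases H : k = g⁻¹
  · subst H
    simp
    ring
  · have h1 : g⁻¹ * h ≠ k * h := fun e => H (mul_right_cancel e).symm
    have h2 : k⁻¹ * g⁻¹ ≠ 1 := fun e => H (inv_mul_eq_one.1 e)
    have h3 : g⁻¹ ≠ k := fun e => H e.symm
    simp [h1, h2, h3]

/-- Pointwise Connes amenability of `ℓ¹(G, ω)` at a point mass `δ_h` yields pointwise
`ω`-amenability of `G` at `h`. -/
theorem pointwiseAmenableGroupAt {h : G}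
    (H : PointwiseConnesAmenableAt.{u, u} (predual ω) (delta ω h)) :
    ω.PointwiseAmenableGroupAt h := by
  obtain ⟨Φ, hΦ⟩ := H.exists_functional
  obtain ⟨N, hN⟩ : ∃ N : StrongDual ℂ (LInf G), ∀ f, N f = Φ (ofLInf ω f) :=
    ⟨Φ ∘L ofLInf ω, fun _ => rfl⟩
  -- Innerness at `δ_h`, tested on the form with support `g k = h`; the left side is its value at
  -- `(1, δ_h)`.
  have key (f : LInf G) : f 1 * (ω 1 * ω 1) =
      N (ω.J h f) - (N f - (f 1 * ω 1) * N ω.omDiag) := by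
    have h1 := hΦ _ (antidiagonal_mem_bilinearPart (norm_mul_symm_le' ω f h))
    rw [right_antidiagonal, left_antidiagonal, ← hN, ← hN, map_sub, map_smul, smul_eq_mul] at h1
    rw [← h1, one_def, antidiagonal_delta_left]
    simp [delta_apply]
  have h1 := ω.ofReal_ne_zero 1
  -- For `f = omDiag` the two invariance terms cancel and only the correction remains. With this
  -- value the correction in `key` equals its left side for every `f`, leaving `N (J_h f) = N f`;
  -- rescaling by `(ω 1)⁻¹` is needed because `ω 1` may exceed 1.
  have h2 : N ω.omDiag = ω 1 := by
    have := key ω.omDiag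
    rw [ω.J_omDiag, ω.omDiag_apply, inv_one] at this
    field_simp at this
    linear_combination -this
  refine ⟨(ω 1 : ℂ)⁻¹ • N, ?_, ?_⟩
  · simp [h2, h1]
  · ext f
    have := key f
    rw [h2] at this
    change (ω 1 : ℂ)⁻¹ * N (ω.J h f) = (ω 1 : ℂ)⁻¹ * N f
    congr 1
    linear_combination -this

/-! ### Averaging a derivation over its orbit -/

section Averaging

variable {X : Type w} [NormedAddCommGroup X] [NormedSpace ℂ X]
  (B : BanachBimodule (Beurling ω) X) (D : Beurling ω →L[ℂ] StrongDual ℂ X)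

theorem norm_orbit_le (x : X) (g : G) : ‖D (delta ω g) (B.left (delta ω g⁻¹) x)‖ ≤
    ‖D‖ * ‖B.left‖ * ‖x‖ * (ω g * ω g⁻¹) :=
  calc _ ≤ ‖D‖ * ‖delta ω g‖ * ‖B.left (delta ω g⁻¹) x‖ := D.le_opNorm₂ _ _
    _ ≤ ‖D‖ * ‖delta ω g‖ * (‖B.left‖ * ‖delta ω g⁻¹‖ * ‖x‖) := by
      gcongr
      exact B.left.le_opNorm₂ _ _
    _ = _ := by
      rw [norm_delta, norm_delta]
      ring

/-- The map `x ↦ (⟨x, D(δ_g) · δ_{g⁻¹}⟩ / (ω(g) ω(g⁻¹)))_g`. -/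
def orbitMap : X →L[ℂ] LInf G :=
  LinearMap.mkContinuous
    { toFun := fun x => ω.divSymm (fun g => D (delta ω g) (B.left (delta ω g⁻¹) x)) _
        (norm_orbit_le B D x)
      map_add' := fun x y => by
        ext g
        simp only [Weight.divSymm_apply, map_add, add_div, lp.coeFn_add, Pi.add_apply]
      map_smul' := fun c x => by
        ext g
        simp only [Weight.divSymm_apply, map_smul, smul_eq_mul, mul_div_assoc, lp.coeFn_smul,
          Pi.smul_apply, RingHom.id_apply] }
    (‖D‖ * ‖B.left‖) fun x => ω.norm_divSymm_le (by positivity) (norm_orbit_le B D x)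

theorem orbitMap_apply (x : X) (g : G) :
    orbitMap B D x g = D (delta ω g) (B.left (delta ω g⁻¹) x) / (ω g * ω g⁻¹) := rfl

variable {B D}

/-- Expand `D(δ_h δ_g)` at `δ_{g⁻¹} · x`. In `D(δ_h) · δ_g` the group elements cancel, leaving a
constant in `g`, hence a multiple of `omDiag`; `δ_h · D(δ_g)` gives the orbit of `x · δ_h`. The unit
is kept explicit because it need not act as the identity. -/
theorem J_orbitMap (hD : B.dual.IsDerivation D) (h : G) (x : X) :
    ω.J h (orbitMap B D (B.left (delta ω h) x)) =
      (D (delta ω h) (B.left 1 x) * (ω 1 : ℂ)⁻¹) • ω.omDiag +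
        orbitMap B D (B.left 1 (B.right (delta ω h) x)) := by
  ext g
  have h1 : ω.J h (orbitMap B D (B.left (delta ω h) x)) g =
      D (delta ω (h * g)) (B.left (delta ω (h * g)⁻¹) (B.left (delta ω h) x)) /
        (ω g * ω g⁻¹) := ω.J_divSymm h _ _ (norm_orbit_le B D _) g
  rw [h1, ← B.left_mul, delta_mul_delta, ← delta_mul_delta, hD, _root_.add_apply,
    BanachBimodule.dual_right_apply, BanachBimodule.dual_left_apply, ← B.left_mul,
    delta_mul_delta, B.left_right]
  simp only [lp.coeFn_add, lp.coeFn_smul, Pi.add_apply, Pi.smul_apply, smul_eq_mul,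
    orbitMap_apply, ω.omDiag_apply, ← B.left_mul, mul_one]
  have h2 := ω.ofReal_ne_zero 1
  rw [one_def]
  simp only [mul_inv_rev, inv_mul_cancel_right, mul_inv_cancel]
  field_simp

/-- Pointwise `ω`-amenability of `G` at `h` yields pointwise amenability of `ℓ¹(G, ω)` at the
point mass `δ_h`. -/
theorem pointwiseAmenableAt_delta {h : G} (H : ω.PointwiseAmenableGroupAt h) :
    PointwiseAmenableAt.{u, w} (Beurling ω) (delta ω h) := by
  intro X _ _ _ B D hD
  obtain ⟨N, hN, hJ⟩ := H
  -- The scalar `ω 1` compensates for the constant function 1 being represented by `(ω 1)⁻¹ •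
  -- omDiag`.
  refine hD.isInnerAt_of_unit (φ := (ω 1 : ℂ) • (N ∘L orbitMap B D)) ?_
  ext x
  have h1 := congrArg N (J_orbitMap hD h x)
  have h2 : N (ω.J h (orbitMap B D (B.left (delta ω h) x))) =
      N (orbitMap B D (B.left (delta ω h) x)) := DFunLike.congr_fun hJ _
  rw [h2, map_add, map_smul, hN, smul_eq_mul, mul_one] at h1
  change D (delta ω h) (B.left 1 x) = ω 1 * N (orbitMap B D (B.left (delta ω h) x)) -
    ω 1 * N (orbitMap B D (B.left 1 (B.right (delta ω h) x)))
  rw [h1]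
  have h3 := ω.ofReal_ne_zero 1
  field_simp
  ring

end Averaging

end Beurling

end

theorem theorem4p7 {G : Type u} [Group G] (ω : Weight G) :
    (PointwiseAmenable.{u, max u v} (Beurling ω) →
      PointwiseConnesAmenable.{u, max u v} (Beurling.predual ω)) ∧
    (PointwiseConnesAmenable.{u, max u v} (Beurling.predual ω) → ω.PointwiseAmenableGroup) ∧
    (ω.PointwiseAmenableGroup →
      ∀ k : G, PointwiseAmenableAt.{u, max u v} (Beurling ω) (Beurling.delta ω k)) :=
  ⟨fun h => h.pointwiseConnesAmenable _,
    fun H h => Beurling.pointwiseAmenableGroupAt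
      (PointwiseConnesAmenableAt.lift.{u, v, u} _ (H (Beurling.delta ω h))),
    fun H k => Beurling.pointwiseAmenableAt_delta (H k)⟩
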